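/- An instance of Orthogonal Vectors (OV) with parameters $n$ and $d$ consists of $n$ vectors $v_1,\dots,v_n\in\{0,1\}^d$; it is a "yes" instance if there are $i\neq j$ with $\langle v_i,v_j\rangle=0$ (inner product over the integers), and a "no" instance otherwise. For $p\in(0,1)$ let $\mathrm{OV}(p)_{n,d}$ be the distribution on instances in which all $nd$ bits are independent, each equal to $1$ with probability $p$ and to $0$ otherwise. Formulas are Boolean formulas over the $nd$ input bits and the constants $0,1$, with NOT gates and with AND and OR gates of unbounded fan-in; the size of a formula is the number of its nodes (leaves and gates), and its depth is the largest number of gates on a path from the root to a leaf. **Theorem.** There are numbers $\varepsilon_p>0$ $(p\in(0,1))$ with $\varepsilon_p\to1$ as $p\to1$, and an absolute constant $D$, such that the following holds for every $p\in(0,1)$. There is a sequence $\delta_p(n)$ with $\delta_p(n)\to0$ as $n\to\infty$ such that for all integers $n\ge1$ and $d\ge0$ there is a formula $F$ over the bits of an OV instance, of depth at most $D$ (an $\mathsf{AC}^0$ formula) and of size at most $n^{2-\varepsilon_p}$, such that: 1. for every instance $x$, if $F(x)=1$ then $x$ is a "yes" instance (so $F$ always outputs $0$ if there is no orthogonal pair);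 2. with probability at least $1-\delta_p(n)$ over $x\sim\mathrm{OV}(p)_{n,d}$, $F$ answers $x$ correctly, that is, $F(x)=1$ if and only if $x$ is a "yes" instance. -/

import Mathlib

open Filter Topology MeasureTheory ProbabilityTheory

/-- Boolean formulas over the variables `ι`: trees whose leaves are variables or constants, with
NOT gates and with AND and OR gates of unbounded fan-in. -/
inductive BoolFormula (ι : Type) : Type
  | var (i : ι) : BoolFormula ι
  | const (b : Bool) : BoolFormula ι
  | not (f : BoolFormula ι) : BoolFormula ι
  | and (k : ℕ) (f : Fin k → BoolFormula ι) : BoolFormula ι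
  | or (k : ℕ) (f : Fin k → BoolFormula ι) : BoolFormula ι

namespace BoolFormula

/-- The value of a formula under an assignment of its variables. -/
def eval {ι : Type} (x : ι → Bool) : BoolFormula ι → Bool
  | var i => x i
  | const b => b
  | not f => !(f.eval x)
  | and _ f => decide (∀ i, (f i).eval x = true)
  | or _ f => decide (∃ i, (f i).eval x = true)

/-- The size of a formula: the number of all its nodes (leaves and gates, NOT gates included). -/
def size {ι : Type} : BoolFormula ι → ℕ
  | var _ => 1
  | const _ => 1
  | not f => f.size + 1
  | and _ f => (∑ i, (f i).size) + 1
  | or _ f => (∑ i, (f i).size) + 1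

/-- The depth of a formula: the largest number of gates (NOT gates included) on a path from the
root to a leaf. -/
def depth {ι : Type} : BoolFormula ι → ℕ
  | var _ => 0
  | const _ => 0
  | not f => f.depth + 1
  | and _ f => (Finset.univ.sup fun i => (f i).depth) + 1
  | or _ f => (Finset.univ.sup fun i => (f i).depth) + 1

end BoolFormula

/-- An instance of Orthogonal Vectors: `n` vectors in `{0,1}^d`. -/
abbrev OVInstance (n d : ℕ) : Type := Fin n → Fin d → Bool

/-- The inner product, over the integers, of two 0/1 vectors. -/
def boolInner {d : ℕ} (u v : Fin d → Bool) : ℕ := ∑ k, (u k).toNat * (v k).toNat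

/-- The instance is a "yes" instance: it has an orthogonal pair of vectors. -/
def OVInstance.HasOrthogonalPair {n d : ℕ} (x : OVInstance n d) : Prop :=
  ∃ i j : Fin n, i ≠ j ∧ boolInner (x i) (x j) = 0

/-- The output of a formula, whose variables are the `n * d` bits of an instance. -/
def BoolFormula.output {n d : ℕ} (F : BoolFormula (Fin n × Fin d)) (x : OVInstance n d) : Bool :=
  F.eval fun ik => x ik.1 ik.2

/-- The distribution `OV(p)_{n,d}`: all bits are independent, `1` with probability `p` and `0`
otherwise. -/
noncomputable def ovMeasure (p : unitInterval) (n d : ℕ) : Measure (OVInstance n d) :=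
  Measure.pi fun _ => Measure.pi fun _ => bernoulliMeasure true false p

/-! Put Λ = -log(1-p²), so that a fixed pair is orthogonal with probability e^{-Λd}; three ranges of
d are treated separately. If Λd ≥ 3 log n, the expected number of orthogonal pairs is at most 1/n
and the constant 0 suffices (`solvable_of_sparse`). If d ≤ a log n, one can try every set S, asking
for a vector vanishing on S and one vanishing off S; the size is about 2^d n, below n^{1+b} for any
b > a (`eventually_solvable_of_dense`). For p near 1, Λ is large and these two ranges cover
everything, with ε_p = 1 - 4/Λ → 1.

For general p there remain d of order log n. Conditioned on orthogonality, the bits of either vector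
of a pair are 1 with probability p/(1+p), which is less than p. Fix θ strictly between and call a
vector light if each of s ≈ √d blocks of length s has at most θs ones. Lightness is tested by brute
force on blocks, at cost 2^{O(√d)} = n^{o(1)}. Orthogonal pairs are almost always light, while an
unconditioned vector is light with probability at most ρ^{s²} = n^{-Ω(1)}. Hence buckets of w = n^η
vectors, η small, rarely contain a light vector besides those of a given orthogonal pair, and two
buckets can be compared through the bitwise OR of their light vectors. This costs about (n/w)²·w =
n^{2-η}, and a positive answer always certifies an orthogonal pair.

The failure probability is bounded by the expected number of orthogonal pairs times a small factor
(`searchFormula_error_le_of_full`), which is useful only while that number is at most log n.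
Otherwise the search is restricted to the first m vectors, with m chosen so that about log n pairs
are expected; a second moment argument (`measure_no_typicalPair_le`) shows that some light pair
survives. To control pairs sharing a vector, the count is truncated to vectors with at least θ'd
ones, where (1-p)^{θ'} = √(1-p²); that θ' < p/(1+p), so that the truncation is harmless, is a
convexity-type inequality (`exists_rpow_eq_sqrt`). -/

namespace BoolFormula

/-! ### Gates indexed by finite sets: semantics, size and depth. -/

variable {ι κ : Type}

/-- Conjunction over a finite set. -/
noncomputable def iAnd (S : Finset κ) (f : κ → BoolFormula ι) : BoolFormula ι :=
  and S.card fun r => f (S.equivFin.symm r)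

/-- Disjunction over a finite set. -/
noncomputable def iOr (S : Finset κ) (f : κ → BoolFormula ι) : BoolFormula ι :=
  or S.card fun r => f (S.equivFin.symm r)

/-- Binary conjunction. -/
noncomputable def andPair (f g : BoolFormula ι) : BoolFormula ι :=
  iAnd Finset.univ fun b : Bool => cond b f g

/-- Binary disjunction. -/
noncomputable def orPair (f g : BoolFormula ι) : BoolFormula ι :=
  iOr Finset.univ fun b : Bool => cond b f g

theorem forall_equivFin_symm (S : Finset κ) (P : κ → Prop) :
    (∀ r, P (S.equivFin.symm r)) ↔ ∀ k ∈ S, P k := by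
  constructor
  · intro h k hk
    simpa using h (S.equivFin ⟨k, hk⟩)
  · intro h r
    exact h _ (S.equivFin.symm r).2

@[simp] theorem eval_var (x : ι → Bool) (i : ι) : (var i).eval x = x i := rfl

@[simp] theorem eval_not (x : ι → Bool) (f : BoolFormula ι) :
    (not f).eval x = true ↔ ¬ f.eval x = true := by
  simp [eval]

@[simp] theorem eval_iAnd (x : ι → Bool) (S : Finset κ) (f : κ → BoolFormula ι) :
    (iAnd S f).eval x = true ↔ ∀ k ∈ S, (f k).eval x = true := by
  simp only [iAnd, eval, decide_eq_true_eq]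
  exact forall_equivFin_symm S fun k => (f k).eval x = true

@[simp] theorem eval_iOr (x : ι → Bool) (S : Finset κ) (f : κ → BoolFormula ι) :
    (iOr S f).eval x = true ↔ ∃ k ∈ S, (f k).eval x = true := by
  simp only [iOr, eval, decide_eq_true_eq]
  constructor
  · rintro ⟨r, hr⟩
    exact ⟨_, (S.equivFin.symm r).2, hr⟩
  · rintro ⟨k, hk, h⟩
    exact ⟨S.equivFin ⟨k, hk⟩, by simpa using h⟩

@[simp] theorem eval_andPair (x : ι → Bool) (f g : BoolFormula ι) :
    (andPair f g).eval x = true ↔ f.eval x = true ∧ g.eval x = true := by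
  simp [andPair, and_comm]

@[simp] theorem eval_orPair (x : ι → Bool) (f g : BoolFormula ι) :
    (orPair f g).eval x = true ↔ f.eval x = true ∨ g.eval x = true := by
  simp [orPair, or_comm]

theorem sum_equivFin_symm (S : Finset κ) (a : κ → ℕ) :
    ∑ r, a (S.equivFin.symm r) = ∑ k ∈ S, a k := by
  rw [Equiv.sum_comp S.equivFin.symm (fun k : S => a k), Finset.sum_coe_sort S a]

theorem size_iAnd_le {S : Finset κ} {f : κ → BoolFormula ι} {c M : ℕ} (hc : S.card ≤ c)
    (h : ∀ k ∈ S, (f k).size ≤ M) : (iAnd S f).size ≤ c * M + 1 := by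
  simp only [iAnd, size, sum_equivFin_symm S fun k => (f k).size]
  gcongr
  calc _ ≤ S.card • M := Finset.sum_le_card_nsmul _ _ _ h
    _ ≤ c * M := by rw [smul_eq_mul]; gcongr

theorem size_iOr_le {S : Finset κ} {f : κ → BoolFormula ι} {c M : ℕ} (hc : S.card ≤ c)
    (h : ∀ k ∈ S, (f k).size ≤ M) : (iOr S f).size ≤ c * M + 1 := by
  simp only [iOr, size, sum_equivFin_symm S fun k => (f k).size]
  gcongr
  calc _ ≤ S.card • M := Finset.sum_le_card_nsmul _ _ _ h
    _ ≤ c * M := by rw [smul_eq_mul]; gcongr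

theorem size_andPair (f g : BoolFormula ι) : (andPair f g).size = f.size + g.size + 1 := by
  simp only [andPair, iAnd, size]
  rw [sum_equivFin_symm Finset.univ fun b : Bool => (cond b f g).size]
  simp

theorem size_orPair (f g : BoolFormula ι) : (orPair f g).size = f.size + g.size + 1 := by
  simp only [orPair, iOr, size]
  rw [sum_equivFin_symm Finset.univ fun b : Bool => (cond b f g).size]
  simp

theorem depth_iAnd_le {S : Finset κ} {f : κ → BoolFormula ι} {D : ℕ}
    (h : ∀ k ∈ S, (f k).depth ≤ D) : (iAnd S f).depth ≤ D + 1 := by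
  simp only [iAnd, depth]
  gcongr
  exact Finset.sup_le fun r _ => h _ (S.equivFin.symm r).2

theorem depth_iOr_le {S : Finset κ} {f : κ → BoolFormula ι} {D : ℕ}
    (h : ∀ k ∈ S, (f k).depth ≤ D) : (iOr S f).depth ≤ D + 1 := by
  simp only [iOr, depth]
  gcongr
  exact Finset.sup_le fun r _ => h _ (S.equivFin.symm r).2

theorem depth_andPair_le {f g : BoolFormula ι} {D : ℕ} (hf : f.depth ≤ D) (hg : g.depth ≤ D) :
    (andPair f g).depth ≤ D + 1 :=
  depth_iAnd_le fun b _ => by cases b <;> assumption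

theorem depth_orPair_le {f g : BoolFormula ι} {D : ℕ} (hf : f.depth ≤ D) (hg : g.depth ≤ D) :
    (orPair f g).depth ≤ D + 1 :=
  depth_iOr_le fun b _ => by cases b <;> assumption

theorem depth_not_le {f : BoolFormula ι} {D : ℕ} (hf : f.depth ≤ D) :
    (not f).depth ≤ D + 1 := by
  simpa [depth] using hf

end BoolFormula

/-- Two 0/1 vectors have disjoint supports. -/
def Orth {d : ℕ} (u v : Fin d → Bool) : Prop := ∀ k, ¬ (u k = true ∧ v k = true)

theorem Orth.symm {d : ℕ} {u v : Fin d → Bool} (h : Orth u v) : Orth v u :=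
  fun k hk => h k hk.symm

theorem boolInner_eq_zero_iff {d : ℕ} (u v : Fin d → Bool) : boolInner u v = 0 ↔ Orth u v := by
  simp only [boolInner, Orth, Finset.sum_eq_zero_iff, Finset.mem_univ, true_imp_iff]
  refine forall_congr' fun k => ?_
  cases u k <;> cases v k <;> simp

theorem OVInstance.hasOrthogonalPair_iff {n d : ℕ} (x : OVInstance n d) :
    x.HasOrthogonalPair ↔ ∃ i j, i ≠ j ∧ Orth (x i) (x j) := by
  simp only [OVInstance.HasOrthogonalPair, boolInner_eq_zero_iff]

/-! ### The formulas: exhaustive search, bucketed search, and the filter. -/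

namespace BoolFormula

variable {n d : ℕ}

/-- The conjunction of the negated bits of the vector `i` over the coordinates in `S`. -/
noncomputable def zeroOn (i : Fin n) (S : Finset (Fin d)) : BoolFormula (Fin n × Fin d) :=
  iAnd S fun k => not (var (i, k))

/-- The exhaustive formula: some vector vanishes on a set `S` of coordinates and some vector
vanishes off `S`. -/
noncomputable def exhaustive (n d : ℕ) : BoolFormula (Fin n × Fin d) :=
  iOr (Finset.univ : Finset (Finset (Fin d))) fun S =>
    andPair (iOr Finset.univ fun i => zeroOn i S) (iOr Finset.univ fun j => zeroOn j Sᶜ)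

theorem output_exhaustive (hn : 2 ≤ n) (x : OVInstance n d) :
    (exhaustive n d).output x = true ↔ x.HasOrthogonalPair := by
  rw [OVInstance.hasOrthogonalPair_iff]
  simp only [output, exhaustive, zeroOn, eval_iOr, eval_andPair, eval_iAnd, eval_not, eval_var,
    Finset.mem_univ, true_and, Finset.mem_compl]
  constructor
  · rintro ⟨S, ⟨i, hi⟩, j, hj⟩
    by_cases hij : i = j
    -- A single vector vanishing on both halves is zero, hence orthogonal to any other; this is
    -- where a second vector is needed.
    · subst hij
      have : Nontrivial (Fin n) := Fin.nontrivial_iff_two_le.2 hn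
      obtain ⟨l, hl⟩ := exists_ne i
      refine ⟨i, l, hl.symm, fun k hk => ?_⟩
      by_cases h : k ∈ S
      · exact hi k h hk.1
      · exact hj k h hk.1
    · refine ⟨i, j, hij, fun k hk => ?_⟩
      by_cases h : k ∈ S
      · exact hi k h hk.1
      · exact hj k h hk.2
  · rintro ⟨i, j, -, h⟩
    refine ⟨Finset.univ.filter fun k => x i k = false, ⟨i, by simp⟩, j,
      fun k hk hjk => h k ⟨?_, hjk⟩⟩
    simpa using hk

theorem size_exhaustive_le :
    (exhaustive n d).size ≤ 2 ^ d * (2 * (n * (2 * d + 1) + 1) + 1) + 1 := by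
  have hz : ∀ (i : Fin n) (S : Finset (Fin d)), (zeroOn i S).size ≤ 2 * d + 1 := fun i S => by
    rw [mul_comm]
    exact size_iAnd_le (by simpa using Finset.card_le_univ S) fun k _ => by simp [size]
  refine size_iOr_le (by simp) fun S _ => ?_
  rw [size_andPair, two_mul (n * (2 * d + 1) + 1)]
  gcongr <;> exact size_iOr_le (by simp) fun i _ => hz _ _

theorem depth_exhaustive_le : (exhaustive n d).depth ≤ 5 :=
  depth_iOr_le fun S _ => depth_andPair_le
    (depth_iOr_le fun i _ => depth_iAnd_le fun k _ => depth_not_le (D := 0) (by simp [depth]))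
    (depth_iOr_le fun i _ => depth_iAnd_le fun k _ => depth_not_le (D := 0) (by simp [depth]))

/-- The formula saying that the vectors `i` and `j` are orthogonal. -/
noncomputable def pairTest (i j : Fin n) : BoolFormula (Fin n × Fin d) :=
  iAnd Finset.univ fun k => not (andPair (var (i, k)) (var (j, k)))

/-- The `k`-th bit of the disjunction of the vectors in `B` that pass the filter `L`. -/
noncomputable def filteredBit (L : Fin n → BoolFormula (Fin n × Fin d)) (B : Finset (Fin n))
    (k : Fin d) : BoolFormula (Fin n × Fin d) :=
  iOr B fun i => andPair (L i) (var (i, k))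

/-- The formula saying that both `B` and `B'` have vectors passing the filter `L` and that all
such vectors of `B` are orthogonal to all such vectors of `B'`. -/
noncomputable def crossTest (L : Fin n → BoolFormula (Fin n × Fin d)) (B B' : Finset (Fin n)) :
    BoolFormula (Fin n × Fin d) :=
  andPair (andPair (iOr B L) (iOr B' L))
    (iAnd Finset.univ fun k => not (andPair (filteredBit L B k) (filteredBit L B' k)))

/-- The formula testing all pairs inside one bucket, and, with `crossTest`, all pairs of
buckets. -/
noncomputable def bucketFormula (L : Fin n → BoolFormula (Fin n × Fin d)) {b : ℕ}
    (𝓑 : Fin b → Finset (Fin n)) : BoolFormula (Fin n × Fin d) :=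
  orPair
    (iOr (Finset.univ : Finset (Fin b)).offDiag fun P => crossTest L (𝓑 P.1) (𝓑 P.2))
    (iOr Finset.univ fun c => iOr (𝓑 c).offDiag fun P => pairTest P.1 P.2)

theorem output_bucketFormula_iff (L : Fin n → BoolFormula (Fin n × Fin d)) {b : ℕ}
    (𝓑 : Fin b → Finset (Fin n)) (x : OVInstance n d) :
    (bucketFormula L 𝓑).output x = true ↔
      (∃ c c', c ≠ c' ∧ (∃ i ∈ 𝓑 c, (L i).output x = true) ∧ (∃ j ∈ 𝓑 c', (L j).output x = true) ∧
        ∀ i ∈ 𝓑 c, ∀ j ∈ 𝓑 c', (L i).output x = true → (L j).output x = true →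
          Orth (x i) (x j)) ∨
      ∃ c, ∃ i ∈ 𝓑 c, ∃ j ∈ 𝓑 c, i ≠ j ∧ Orth (x i) (x j) := by
  simp only [output, bucketFormula, crossTest, filteredBit, pairTest, eval_orPair, eval_iOr,
    eval_andPair, eval_iAnd, eval_not, eval_var, Finset.mem_univ, true_and, true_imp_iff,
    Finset.mem_offDiag, Prod.exists, Orth]
  refine or_congr (exists_congr fun c => exists_congr fun c' => and_congr_right fun _ => ?_)
    (exists_congr fun c => ?_)
  · rw [and_assoc]
    refine and_congr_right fun _ => and_congr_right fun _ => ?_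
    grind
  · grind

/-- Soundness asks nothing of the filter: each bucket has a passing vector and disjoint ORs make
every passing cross pair orthogonal. Disjointness of the buckets keeps the two indices distinct. -/
theorem hasOrthogonalPair_of_output_bucketFormula (L : Fin n → BoolFormula (Fin n × Fin d)) {b : ℕ}
    (𝓑 : Fin b → Finset (Fin n)) (hB : ∀ c c', c ≠ c' → Disjoint (𝓑 c) (𝓑 c'))
    (x : OVInstance n d) (h : (bucketFormula L 𝓑).output x = true) : x.HasOrthogonalPair := by
  rw [OVInstance.hasOrthogonalPair_iff]
  rcases (output_bucketFormula_iff L 𝓑 x).1 h with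
    ⟨c, c', hc, ⟨i, hi, hLi⟩, ⟨j, hj, hLj⟩, ho⟩ | ⟨c, i, hi, j, hj, hij, ho⟩
  · refine ⟨i, j, ?_, ho i hi j hj hLi hLj⟩
    rintro rfl
    exact Finset.disjoint_left.1 (hB c c' hc) hi hj
  · exact ⟨i, j, hij, ho⟩

/-- When nothing else passes, the two filtered ORs are the vectors themselves. If both lie in one
bucket, the unfiltered test inside that bucket finds them. -/
theorem output_bucketFormula_of_isolated (L : Fin n → BoolFormula (Fin n × Fin d)) {b : ℕ}
    (𝓑 : Fin b → Finset (Fin n)) (x : OVInstance n d) {i j : Fin n} (hij : i ≠ j)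
    (ho : Orth (x i) (x j)) {c c' : Fin b} (hi : i ∈ 𝓑 c) (hj : j ∈ 𝓑 c')
    (hLi : (L i).output x = true) (hLj : (L j).output x = true)
    (hc : ∀ l ∈ 𝓑 c, l ≠ i → l ≠ j → ¬ (L l).output x = true)
    (hc' : ∀ l ∈ 𝓑 c', l ≠ i → l ≠ j → ¬ (L l).output x = true)
    (hB : ∀ c c', c ≠ c' → Disjoint (𝓑 c) (𝓑 c')) :
    (bucketFormula L 𝓑).output x = true := by
  rw [output_bucketFormula_iff]
  by_cases h : c = c'
  · subst h
    exact .inr ⟨c, i, hi, j, hj, hij, ho⟩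
  · refine .inl ⟨c, c', h, ⟨i, hi, hLi⟩, ⟨j, hj, hLj⟩, fun i' hi' j' hj' hLi' hLj' => ?_⟩
    have hd := Finset.disjoint_left.1 (hB c c' h)
    have h1 : i' = i := by
      by_contra hne
      exact hc i' hi' hne (fun e => hd hi' (e ▸ hj)) hLi'
    have h2 : j' = j := by
      by_contra hne
      exact hc' j' hj' (fun e => hd hi (e ▸ hj')) hne hLj'
    rwa [h1, h2]

theorem size_bucketFormula_le (L : Fin n → BoolFormula (Fin n × Fin d)) {b : ℕ}
    (𝓑 : Fin b → Finset (Fin n)) {M w : ℕ} (hM : ∀ i, (L i).size ≤ M) (hw : ∀ c, (𝓑 c).card ≤ w) :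
    (bucketFormula L 𝓑).size ≤
      b ^ 2 * (2 * (w * M + 1) + d * (2 * (w * (M + 2) + 1) + 2) + 3) +
        b * (w ^ 2 * (4 * d + 1) + 1) + 3 := by
  have hpair : ∀ i j : Fin n, (pairTest i j : BoolFormula (Fin n × Fin d)).size ≤ 4 * d + 1 :=
    fun i j => by
      rw [mul_comm]
      exact size_iAnd_le (by simp) fun k _ => by simp [size, size_andPair]
  have hoff : ∀ {κ : Type} [DecidableEq κ] (S : Finset κ) (c : ℕ), S.card ≤ c →
      S.offDiag.card ≤ c ^ 2 := fun S c h => by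
    rw [Finset.offDiag_card, sq]
    exact (Nat.sub_le _ _).trans (Nat.mul_le_mul h h)
  have hbit : ∀ c k, (filteredBit L (𝓑 c) k).size ≤ w * (M + 2) + 1 := fun c k =>
    size_iOr_le (hw c) fun i _ => by
      rw [size_andPair]
      have := hM i
      simp only [size]
      omega
  have hex : ∀ c, (iOr (𝓑 c) L).size ≤ w * M + 1 := fun c => size_iOr_le (hw c) fun i _ => hM i
  have hcross : ∀ c c', (crossTest L (𝓑 c) (𝓑 c')).size ≤
      2 * (w * M + 1) + d * (2 * (w * (M + 2) + 1) + 2) + 3 := fun c c' => by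
    have h1 : (iAnd Finset.univ fun k => not (andPair (filteredBit L (𝓑 c) k)
        (filteredBit L (𝓑 c') k))).size ≤ d * (2 * (w * (M + 2) + 1) + 2) + 1 :=
      size_iAnd_le (by simp) fun k _ => by
        have h1 := hbit c k
        have h2 := hbit c' k
        simp only [size, size_andPair]
        omega
    have h2 := hex c
    have h3 := hex c'
    simp only [crossTest, size_andPair]
    omega
  rw [bucketFormula, size_orPair]
  have h1 := size_iOr_le (f := fun P : Fin b × Fin b => crossTest L (𝓑 P.1) (𝓑 P.2))
    (hoff Finset.univ b (by simp)) fun P _ => hcross P.1 P.2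
  have h2 := size_iOr_le (S := Finset.univ) (c := b)
    (f := fun c : Fin b => iOr (𝓑 c).offDiag fun P =>
      (pairTest P.1 P.2 : BoolFormula (Fin n × Fin d)))
    (by simp) fun c _ => size_iOr_le (hoff _ w (hw c)) fun P _ => hpair P.1 P.2
  omega

theorem depth_bucketFormula_le (L : Fin n → BoolFormula (Fin n × Fin d)) {b : ℕ}
    (𝓑 : Fin b → Finset (Fin n)) (hL : ∀ i, (L i).depth ≤ 3) :
    (bucketFormula L 𝓑).depth ≤ 12 := by
  have hbit : ∀ c k, (filteredBit L (𝓑 c) k).depth ≤ 5 := fun c k =>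
    depth_iOr_le fun i _ => depth_andPair_le (hL i) (by simp [depth])
  refine (depth_orPair_le (D := 11) ?_ ?_)
  · refine (depth_iOr_le (D := 9) fun P _ => depth_andPair_le (D := 8) ?_ ?_).trans (by norm_num)
    · exact (depth_andPair_le (depth_iOr_le fun i _ => hL i) (depth_iOr_le fun i _ => hL i)).trans
        (by norm_num)
    · exact depth_iAnd_le fun k _ => depth_not_le (depth_andPair_le (hbit _ _) (hbit _ _))
  · refine (depth_iOr_le (D := 4) fun c _ => depth_iOr_le fun P _ => depth_iAnd_le fun k _ =>
      depth_not_le (depth_andPair_le (D := 0) ?_ ?_)).trans (by norm_num) <;> simp [depth]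

/-- The filter given by a family `𝒯` of sets of coordinates: the vector `i` has a zero in each of
the sets. -/
noncomputable def zeroInEach (𝒯 : Finset (Finset (Fin d))) (i : Fin n) :
    BoolFormula (Fin n × Fin d) :=
  iAnd 𝒯 fun T => iOr T fun k => not (var (i, k))

theorem output_zeroInEach (𝒯 : Finset (Finset (Fin d))) (i : Fin n) (x : OVInstance n d) :
    (zeroInEach 𝒯 i).output x = true ↔ ∀ T ∈ 𝒯, ∃ k ∈ T, ¬ x i k = true := by
  simp only [output, zeroInEach, eval_iAnd, eval_iOr, eval_not, eval_var]

theorem size_zeroInEach_le (𝒯 : Finset (Finset (Fin d))) (i : Fin n) {s : ℕ}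
    (hs : ∀ T ∈ 𝒯, T.card ≤ s) : (zeroInEach 𝒯 i).size ≤ 𝒯.card * (2 * s + 1) + 1 :=
  size_iAnd_le le_rfl fun T hT => by
    rw [mul_comm 2]
    exact size_iOr_le (hs T hT) fun k _ => by simp [size]

theorem depth_zeroInEach_le (𝒯 : Finset (Finset (Fin d))) (i : Fin n) :
    (zeroInEach 𝒯 i).depth ≤ 3 :=
  depth_iAnd_le fun T _ => depth_iOr_le fun k _ => depth_not_le (D := 0) (by simp [depth])

end BoolFormula

/-- The probability of the value `b` of a bit that is `true` with probability `p`. -/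
def bitWeight (p : ℝ) (b : Bool) : ℝ := cond b p (1 - p)

/-! ### The product distribution: columns, subfamilies of vectors, second moments. -/

section Distribution

variable {n d r : ℕ} {p : unitInterval}

instance : IsProbabilityMeasure (ovMeasure p n d) := by
  unfold ovMeasure
  infer_instance

theorem ovMeasure_real_singleton (x : OVInstance n d) :
    (ovMeasure p n d).real {x} = ∏ i, ∏ k, bitWeight p (x i k) := by
  simp only [ovMeasure, measureReal_def, Measure.pi_singleton, ENNReal.toReal_prod]
  refine Finset.prod_congr rfl fun i _ => Finset.prod_congr rfl fun k _ => ?_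
  rw [← measureReal_def, bernoulliMeasure_real_apply p (by simp)]
  cases x i k <;> simp [bitWeight]

theorem integral_ovMeasure (f : OVInstance n d → ℝ) :
    ∫ x, f x ∂ovMeasure p n d = ∑ x, (∏ i, ∏ k, bitWeight p (x i k)) * f x := by
  rw [integral_fintype .of_finite]
  simp only [ovMeasure_real_singleton, smul_eq_mul]

/-- The columns of an instance are independent. All exponential moments below are of this product
form, with one, two or three rows. -/
theorem integral_prod_columns (g : Fin d → (Fin r → Bool) → ℝ) :
    ∫ y, ∏ k, g k (fun i => y i k) ∂ovMeasure p r d =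
      ∏ k, ∑ c : Fin r → Bool, (∏ i, bitWeight p (c i)) * g k c := by
  rw [integral_ovMeasure, Finset.prod_univ_sum, Fintype.piFinset_univ]
  refine Fintype.sum_equiv (Equiv.piComm fun _ _ => Bool) _ _ fun y => ?_
  rw [Finset.prod_comm, ← Finset.prod_mul_distrib]
  rfl

theorem iIndepFun_vectors :
    iIndepFun (fun (i : Fin n) (x : OVInstance n d) => x i) (ovMeasure p n d) := by
  unfold ovMeasure
  exact iIndepFun_pi (X := fun _ => id) fun _ => aemeasurable_id

/-- Reduces events about a few distinct vectors to an instance with only those vectors. -/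
theorem ovMeasure_map_comp {e : Fin r → Fin n} (he : Function.Injective e) :
    (ovMeasure p n d).map (fun x a => x (e a)) = ovMeasure p r d := by
  have h := (iIndepFun_vectors (p := p) (n := n) (d := d)).precomp he
  rw [iIndepFun.map_fun_eq_pi_map (fun _ => (measurable_pi_apply _).aemeasurable) h]
  conv_rhs => rw [ovMeasure]
  congr 1
  funext a
  exact (measurePreserving_eval _ (e a)).map_eq

theorem ovMeasure_real_comp {e : Fin r → Fin n} (he : Function.Injective e)
    (S : Set (OVInstance r d)) :
    (ovMeasure p n d).real {x | (fun a => x (e a)) ∈ S} = (ovMeasure p r d).real S := by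
  rw [← ovMeasure_map_comp he, map_measureReal_apply (by fun_prop) (.of_discrete)]
  rfl

theorem measureReal_le_integral {Ω : Type*} [MeasurableSpace Ω] [Finite Ω]
    [MeasurableSingletonClass Ω] (μ : Measure Ω) [IsFiniteMeasure μ] {S : Set Ω} {f : Ω → ℝ}
    (h0 : ∀ x, 0 ≤ f x) (h1 : ∀ x ∈ S, 1 ≤ f x) : μ.real S ≤ ∫ x, f x ∂μ := by
  rw [← integral_indicator_one (.of_discrete)]
  refine integral_mono .of_finite .of_finite fun x => ?_
  by_cases hx : x ∈ S
  · simpa [hx] using h1 x hx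
  · simpa [hx] using h0 x

theorem measureReal_biUnion_le_card_mul {Ω κ : Type*} [MeasurableSpace Ω] (μ : Measure Ω)
    [IsFiniteMeasure μ] (s : Finset κ) (A : κ → Set Ω) {N : ℕ} {b : ℝ} (hN : s.card ≤ N)
    (hb : 0 ≤ b) (h : ∀ a ∈ s, μ.real (A a) ≤ b) : μ.real (⋃ a ∈ s, A a) ≤ N * b :=
  calc _ ≤ ∑ a ∈ s, μ.real (A a) := measureReal_biUnion_finset_le _ _
    _ ≤ s.card • b := Finset.sum_le_card_nsmul _ _ _ h
    _ ≤ N * b := by rw [nsmul_eq_mul]; gcongr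

/-- The second moment bound for the probability that no event of a finite family occurs. -/
theorem second_moment {Ω κ : Type*} [MeasurableSpace Ω] [Finite Ω]
    [MeasurableSingletonClass Ω] (μ : Measure Ω) [IsProbabilityMeasure μ] [Fintype κ]
    (A : κ → Set Ω) :
    μ.real {x | ∀ a, x ∉ A a} * (∑ a, μ.real (A a)) ^ 2 ≤
      ∑ a, ∑ b, μ.real (A a ∩ A b) - (∑ a, μ.real (A a)) ^ 2 := by
  classical
  set M := ∑ a, μ.real (A a) with hM
  set X : Ω → ℝ := fun x => ∑ a, (A a).indicator 1 x with hX
  have hXint : ∫ x, X x ∂μ = M := by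
    rw [hX, integral_finsetSum _ fun _ _ => .of_finite]
    simp only [integral_indicator_one (MeasurableSet.of_discrete), hM]
  have hXX : ∫ x, X x * X x ∂μ = ∑ a, ∑ b, μ.real (A a ∩ A b) := by
    simp only [hX, Finset.sum_mul_sum]
    rw [integral_finsetSum _ fun _ _ => .of_finite]
    refine Finset.sum_congr rfl fun a _ => ?_
    rw [integral_finsetSum _ fun _ _ => .of_finite]
    refine Finset.sum_congr rfl fun b _ => ?_
    rw [← integral_indicator_one (MeasurableSet.of_discrete), Set.inter_indicator_one]
    rfl
  have hvar : ∫ x, (X x - M) ^ 2 ∂μ = ∑ a, ∑ b, μ.real (A a ∩ A b) - M ^ 2 := by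
    have : ∀ x, (X x - M) ^ 2 = X x * X x - (2 * M) * X x + M ^ 2 := fun x => by ring
    simp only [this]
    rw [integral_add .of_finite .of_finite, integral_sub .of_finite .of_finite,
      integral_const_mul, hXint, hXX]
    simp
    ring
  -- Chebyshev: where no event occurs the count `X` is 0, so its squared deviation is `M ^ 2`.
  rw [← hvar, ← integral_indicator_one (MeasurableSet.of_discrete), ← integral_mul_const]
  refine integral_mono .of_finite .of_finite fun x => ?_
  by_cases hx : ∀ a, x ∉ A a
  · have : X x = 0 := by simp [hX, hx]
    simp [this, hx]
  · have hx' : x ∉ {x | ∀ a, x ∉ A a} := hx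
    simp only [Set.indicator_of_notMem hx', zero_mul]
    positivity

end Distribution

/-- The number of ones of `u` in the set `A` of coordinates. -/
def ones {d : ℕ} (u : Fin d → Bool) (A : Finset (Fin d)) : ℕ := (A.filter fun k => u k = true).card

/-! ### Exponential moments of the number of ones, with and without orthogonality. -/

section Tilting

variable {n d : ℕ} {p : unitInterval}

theorem pow_ones (t : ℝ) (u : Fin d → Bool) (A : Finset (Fin d)) :
    t ^ ones u A = ∏ k, if k ∈ A then (if u k = true then t else 1) else 1 := by
  rw [Finset.prod_ite_mem, Finset.univ_inter, Finset.prod_ite]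
  simp [ones]

open Classical in
theorem ite_orth (u v : Fin d → Bool) :
    (if Orth u v then (1 : ℝ) else 0) =
      ∏ k, if u k = true ∧ v k = true then (0 : ℝ) else 1 := by
  split_ifs with h
  · exact (Finset.prod_eq_one fun k _ => if_neg (h k)).symm
  · simp only [Orth, not_forall, not_not] at h
    obtain ⟨k, hk⟩ := h
    symm
    exact Finset.prod_eq_zero (Finset.mem_univ k) (if_pos hk)

theorem sum_boolVec_one (f : (Fin 1 → Bool) → ℝ) : ∑ c, f c = f ![true] + f ![false] := by
  rw [← (Equiv.funUnique (Fin 1) Bool).symm.sum_comp]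
  simp only [Fintype.sum_bool]
  congr 2 <;> · ext i; fin_cases i; rfl

theorem sum_boolVec_succ {r : ℕ} (f : (Fin (r + 1) → Bool) → ℝ) :
    ∑ c, f c = ∑ c, f (Fin.cons true c) + ∑ c, f (Fin.cons false c) := by
  rw [← (Fin.consEquiv fun _ => Bool).sum_comp, Fintype.sum_prod_type, Fintype.sum_bool]
  rfl

theorem measure_pow_ones_le (i : Fin n) (A : Finset (Fin d)) {t T : ℝ} (ht : 0 < t) (hT : 0 < T) :
    (ovMeasure p n d).real {x | T ≤ t ^ ones (x i) A} ≤ (1 - p + p * t) ^ A.card / T := by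
  have he : Function.Injective (![i] : Fin 1 → Fin n) := Function.injective_of_subsingleton _
  have h := ovMeasure_real_comp (p := p) (d := d) he {y | T ≤ t ^ ones (y 0) A}
  simp only [Set.mem_ofPred_eq, Matrix.cons_val_zero] at h
  rw [h]
  calc _ ≤ ∫ y, t ^ ones (y 0) A / T ∂ovMeasure p 1 d :=
        measureReal_le_integral _ (fun y => by positivity) fun y hy => (one_le_div hT).2 hy
    _ = _ := by
        rw [integral_div]
        congr 1
        simp only [pow_ones]
        rw [integral_prod_columns (r := 1) fun k c =>
          if k ∈ A then (if c 0 = true then t else 1) else 1]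
        rw [← Finset.prod_const, ← Finset.prod_subset (Finset.subset_univ A)]
        · refine Finset.prod_congr rfl fun k hk => ?_
          simp [sum_boolVec_one, hk, bitWeight]
          ring
        · intro k _ hk
          simp [sum_boolVec_one, hk, bitWeight]

/-- Forbidding the column (1,1) leaves mass 1-p², of which p(1-p) has first bit 1. So, given
orthogonality, the bits of the first vector are independent with bias p(1-p)/(1-p²) = p/(1+p). -/
theorem integral_orth_mul_pow_ones [DecidablePred fun y : OVInstance 2 d => Orth (y 0) (y 1)]
    (A : Finset (Fin d)) (t : ℝ) :
    ∫ y, (if Orth (y 0) (y 1) then (1 : ℝ) else 0) * t ^ ones (y 0) A ∂ovMeasure p 2 d =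
      (1 - (p : ℝ) ^ 2) ^ d * ((1 + p * t) / (1 + p)) ^ A.card := by
  have hp := p.2.1
  have : ∀ y : OVInstance 2 d, (if Orth (y 0) (y 1) then (1 : ℝ) else 0) * t ^ ones (y 0) A =
      ∏ k, (if y 0 k = true ∧ y 1 k = true then 0 else 1) *
        (if k ∈ A then (if y 0 k = true then t else 1) else 1) := fun y => by
    rw [Finset.prod_mul_distrib, ← pow_ones, ← ite_orth]
    congr
  simp only [this]
  rw [integral_prod_columns (r := 2) fun k c => (if c 0 = true ∧ c 1 = true then 0 else 1) *
    (if k ∈ A then (if c 0 = true then t else 1) else 1)]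
  have h2 : ∀ k : Fin d, (∑ c : Fin 2 → Bool, (∏ i, bitWeight p (c i)) *
      ((if c 0 = true ∧ c 1 = true then 0 else 1) *
        (if k ∈ A then (if c 0 = true then t else 1) else 1))) =
      (1 - (p : ℝ) ^ 2) * if k ∈ A then (1 + p * t) / (1 + p) else 1 := fun k => by
    simp only [sum_boolVec_succ, Fin.prod_univ_two]
    by_cases hk : k ∈ A <;> simp [hk, bitWeight, Fin.cons_one] <;> field_simp <;> ring
  simp only [h2]
  rw [Finset.prod_mul_distrib, Finset.prod_ite_mem]
  simp [div_pow]

theorem measure_orth_pow_ones_le {i j : Fin n} (hij : i ≠ j) (A : Finset (Fin d)) {t T : ℝ}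
    (ht : 0 < t) (hT : 0 < T) :
    (ovMeasure p n d).real {x | Orth (x i) (x j) ∧ T ≤ t ^ ones (x i) A} ≤
      (1 - (p : ℝ) ^ 2) ^ d * (((1 + p * t) / (1 + p)) ^ A.card / T) := by
  classical
  have he : Function.Injective (![i, j] : Fin 2 → Fin n) := by
    intro a b; fin_cases a <;> fin_cases b <;> simp [hij, hij.symm]
  have h := ovMeasure_real_comp (p := p) (d := d) he
    {y | Orth (y 0) (y 1) ∧ T ≤ t ^ ones (y 0) A}
  simp only [Set.mem_ofPred_eq, Matrix.cons_val_zero, Matrix.cons_val_one] at h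
  rw [h, ← mul_div_assoc, ← integral_orth_mul_pow_ones, ← integral_div]
  refine measureReal_le_integral _ (fun y => by positivity) fun y hy => ?_
  simpa [hy.1] using (one_le_div hT).2 hy.2

theorem measure_orth {i j : Fin n} (hij : i ≠ j) :
    (ovMeasure p n d).real {x | Orth (x i) (x j)} = (1 - (p : ℝ) ^ 2) ^ d := by
  classical
  have he : Function.Injective (![i, j] : Fin 2 → Fin n) := by
    intro a b; fin_cases a <;> fin_cases b <;> simp [hij, hij.symm]
  have h := ovMeasure_real_comp (p := p) (d := d) he {y | Orth (y 0) (y 1)}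
  simp only [Set.mem_ofPred_eq, Matrix.cons_val_zero, Matrix.cons_val_one] at h
  have h2 := integral_orth_mul_pow_ones (p := p) (d := d) ∅ 1
  rw [h, ← integral_indicator_one (.of_discrete)]
  simpa [Set.indicator_apply] using h2

/-- In each column either the first bit is 0 and the others are free, or it is 1 and both others
must be 0; then Markov. -/
theorem measure_two_orth_pow_ones_le {i j l : Fin n} (hij : i ≠ j) (hil : i ≠ l) (hjl : j ≠ l)
    {t T : ℝ} (ht : 0 < t) (hT : 0 < T) :
    (ovMeasure p n d).real
        {x | Orth (x i) (x j) ∧ Orth (x i) (x l) ∧ T ≤ t ^ ones (x i) Finset.univ} ≤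
      (1 - p + p * (1 - p) ^ 2 * t) ^ d / T := by
  classical
  have he : Function.Injective (![i, j, l] : Fin 3 → Fin n) := by
    intro a b
    fin_cases a <;> fin_cases b <;> simp [hij, hij.symm, hil, hil.symm, hjl, hjl.symm]
  have h := ovMeasure_real_comp (p := p) (d := d) he
    {y | Orth (y 0) (y 1) ∧ Orth (y 0) (y 2) ∧ T ≤ t ^ ones (y 0) Finset.univ}
  simp only [Set.mem_ofPred_eq, Matrix.cons_val_zero, Matrix.cons_val_one, Matrix.cons_val] at h
  rw [h]
  calc _ ≤ ∫ y, ((if Orth (y 0) (y 1) then (1 : ℝ) else 0) *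
          (if Orth (y 0) (y 2) then (1 : ℝ) else 0) * t ^ ones (y 0) Finset.univ) / T
            ∂ovMeasure p 3 d := by
        refine measureReal_le_integral _ (fun y => by positivity) fun y hy => ?_
        simpa [hy.1, hy.2.1] using (one_le_div hT).2 hy.2.2
    _ = _ := by
        rw [integral_div]
        congr 1
        simp only [ite_orth, pow_ones, ← Finset.prod_mul_distrib]
        rw [integral_prod_columns (r := 3) fun k c => (if c 0 = true ∧ c 1 = true then 0 else 1) *
          (if c 0 = true ∧ c 2 = true then 0 else 1) *
          (if k ∈ Finset.univ then (if c 0 = true then t else 1) else 1)]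
        have hc : ∏ _k : Fin d, (1 - (p : ℝ) + p * (1 - p) ^ 2 * t) =
            (1 - p + p * (1 - p) ^ 2 * t) ^ d := by simp
        rw [← hc]
        refine Finset.prod_congr rfl fun k _ => ?_
        have hcons : ∀ (a b c : Bool) (f : Fin 0 → Bool),
            (Fin.cons a (Fin.cons b (Fin.cons c f)) : Fin 3 → Bool) 2 = c := fun _ _ _ _ => rfl
        simp only [sum_boolVec_succ, Fin.prod_univ_three]
        simp [bitWeight, Fin.cons_one, hcons]
        ring

end Tilting

/-! ### Light vectors and Chernoff bounds. -/

section Light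

variable {n d : ℕ} {p : unitInterval}

/-- The `c`-th block of `s` consecutive coordinates. -/
def block (d s c : ℕ) : Finset (Fin d) := Finset.univ.filter fun k => k.val / s = c

/-- The vector `u` has at most `θ * s` ones in each of the first `s` blocks of length `s`. -/
def IsLight {d : ℕ} (s : ℕ) (θ : ℝ) (u : Fin d → Bool) : Prop :=
  ∀ c < s, (ones u (block d s c) : ℝ) ≤ θ * s

open Classical in
/-- The subsets of the first `s` blocks of length `s` with more than `θ * s` elements. -/
noncomputable def heavySets (d s : ℕ) (θ : ℝ) : Finset (Finset (Fin d)) :=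
  (Finset.range s).biUnion fun c => (block d s c).powerset.filter fun T => θ * s < T.card

theorem card_filter_div_le {n m w : ℕ} (hw : 0 < w) (c : ℕ) :
    (Finset.univ.filter fun i : Fin n => i.val < m ∧ i.val / w = c).card ≤ w := by
  calc _ ≤ (Finset.Ico (c * w) (c * w + w)).card := by
        refine Finset.card_le_card_of_injOn Fin.val (fun i hi => ?_) Fin.val_injective.injOn
        obtain ⟨-, h⟩ := (Finset.mem_filter.1 (Finset.mem_coe.1 hi)).2
        simp only [Finset.coe_Ico, Set.mem_Ico]
        rw [Nat.div_eq_iff hw] at h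
        omega
    _ = w := by simp

theorem card_block_le {s : ℕ} (hs : 0 < s) (c : ℕ) : (block d s c).card ≤ s := by
  refine le_trans (Finset.card_le_card fun k hk => ?_) (card_filter_div_le (n := d) (m := d) hs c)
  simpa [block] using hk

/-- If a block has too many ones, its support there is itself a heavy set without zeros. This turns
counting into an AND of ORs. -/
theorem forall_heavySets_iff (s : ℕ) (θ : ℝ) (u : Fin d → Bool) :
    (∀ T ∈ heavySets d s θ, ∃ k ∈ T, ¬ u k = true) ↔ IsLight s θ u := by
  simp only [heavySets, Finset.mem_biUnion, Finset.mem_filter, Finset.mem_powerset,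
    Finset.mem_range, IsLight]
  constructor
  · intro h c hc
    by_contra hlt
    obtain ⟨k, hk, hu⟩ := h ((block d s c).filter fun k => u k = true)
      ⟨c, hc, Finset.filter_subset _ _, not_le.1 hlt⟩
    exact hu (Finset.mem_filter.1 hk).2
  · rintro h T ⟨c, hc, hT, hlt⟩
    by_contra hall
    push Not at hall
    have h1 : T.card ≤ ones u (block d s c) :=
      Finset.card_le_card fun k hk => Finset.mem_filter.2 ⟨hT hk, hall k hk⟩
    have h2 : (T.card : ℝ) ≤ ones u (block d s c) := by exact_mod_cast h1
    linarith [h c hc]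

theorem card_heavySets_le {s : ℕ} (hs : 0 < s) (θ : ℝ) : (heavySets d s θ).card ≤ s * 2 ^ s := by
  refine Finset.card_biUnion_le.trans ((Finset.sum_le_card_nsmul _ _ (2 ^ s) fun c _ => ?_).trans
    (by simp))
  refine (Finset.card_filter_le _ _).trans ?_
  rw [Finset.card_powerset]
  exact Nat.pow_le_pow_right two_pos (card_block_le hs c)

theorem card_le_of_mem_heavySets {s : ℕ} (hs : 0 < s) (θ : ℝ) {T : Finset (Fin d)}
    (hT : T ∈ heavySets d s θ) : T.card ≤ s := by
  simp only [heavySets, Finset.mem_biUnion, Finset.mem_filter, Finset.mem_powerset] at hT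
  obtain ⟨c, -, h, -⟩ := hT
  exact (Finset.card_le_card h).trans (card_block_le hs c)

theorem IsLight.ones_le {s : ℕ} {θ : ℝ} {u : Fin d → Bool} (h : IsLight s θ u) :
    (ones u (Finset.univ.filter fun k : Fin d => k.val / s < s) : ℝ) ≤ θ * (s * s) := by
  have h1 : ones u (Finset.univ.filter fun k : Fin d => k.val / s < s) =
      ∑ c ∈ Finset.range s, ones u (block d s c) := by
    rw [ones, Finset.card_eq_sum_card_fiberwise (f := fun k : Fin d => k.val / s)
      (t := Finset.range s)]
    · refine Finset.sum_congr rfl fun c hc => ?_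
      rw [ones]
      congr 1
      ext k
      have := Finset.mem_range.1 hc
      simp only [block, Finset.mem_filter, Finset.mem_univ, true_and]
      grind
    · intro k hk
      simp at hk ⊢
      exact hk.1
  rw [h1]
  push_cast
  calc _ ≤ (Finset.range s).card • (θ * s) :=
        Finset.sum_le_card_nsmul _ _ _ fun c hc => h c (Finset.mem_range.1 hc)
    _ = θ * (s * s) := by simp; ring

theorem card_blocks {s : ℕ} (hs : 0 < s) (hsd : s * s ≤ d) :
    (Finset.univ.filter fun k : Fin d => k.val / s < s).card = s * s := by
  simp only [Nat.div_lt_iff_lt_mul hs]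
  rw [← Finset.card_range (s * s)]
  refine Finset.card_bij (fun k _ => k.val) (fun k hk => by simpa using hk)
    (fun a _ b _ h => Fin.ext h) fun b hb => ?_
  have hb := Finset.mem_range.1 hb
  exact ⟨⟨b, hb.trans_le hsd⟩, by simpa using hb, rfl⟩

/-- With u = (θ-a)/2, compare e^u ≤ 1+u+u² with e^{uθ} ≥ 1+uθ; as θ = a+2u, what is left is au² <
2u². The sign of u is free, so both tails are covered. -/
theorem one_sub_add_mul_exp_lt {a θ : ℝ} (ha : 0 < a) (ha1 : a < 1) (hθ : 0 < θ) (hθ1 : θ < 1)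
    (h : a ≠ θ) : 1 - a + a * Real.exp ((θ - a) / 2) < Real.exp ((θ - a) / 2 * θ) := by
  set u := (θ - a) / 2 with hu
  have hu0 : u ≠ 0 := by
    rw [hu]; intro h0; apply h; linarith
  have h1 : |u| ≤ 1 := by rw [abs_le]; constructor <;> rw [hu] <;> linarith
  have h2 := (abs_le.1 (Real.abs_exp_sub_one_sub_id_le h1)).2
  have h3 := Real.add_one_le_exp (u * θ)
  have h4 : 0 < u ^ 2 * (2 - a) := mul_pos (by positivity) (by linarith)
  have h5 : a * (u + u ^ 2) < θ * u := by
    have : θ = a + 2 * u := by rw [hu]; ring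
    rw [this]; nlinarith
  nlinarith

/-- The Chernoff factor for the probability that the mean of independent bits of expectation `a`
is on the other side of `θ`. -/
noncomputable def chernoff (a θ : ℝ) : ℝ :=
  (1 - a + a * Real.exp ((θ - a) / 2)) / Real.exp ((θ - a) / 2 * θ)

theorem chernoff_pos {a θ : ℝ} (ha : 0 < a) (ha1 : a < 1) : 0 < chernoff a θ := by
  have : 0 < 1 - a := by linarith
  unfold chernoff
  positivity

theorem chernoff_lt_one {a θ : ℝ} (ha : 0 < a) (ha1 : a < 1) (hθ : 0 < θ) (hθ1 : θ < 1)
    (h : a ≠ θ) : chernoff a θ < 1 :=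
  (div_lt_one (Real.exp_pos _)).2 (one_sub_add_mul_exp_lt ha ha1 hθ hθ1 h)

theorem exp_mul_pow (u θ : ℝ) (s : ℕ) : Real.exp (u * θ) ^ s = Real.exp (u * (θ * s)) := by
  rw [← Real.exp_nat_mul]; ring_nf

theorem exp_le_exp_pow {u θ : ℝ} {s m : ℕ} (h : u * (θ * s) ≤ u * m) :
    Real.exp (u * θ) ^ s ≤ Real.exp u ^ m := by
  rw [exp_mul_pow, ← Real.exp_nat_mul]
  exact Real.exp_le_exp.2 (by linarith)

/-- Lightness bounds the ones on all s² coordinates together, hence the exponent s² and a bound that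
can beat a power of n. -/
theorem measure_isLight_le (i : Fin n) {s : ℕ} (hs : 0 < s) (hsd : s * s ≤ d) {θ : ℝ}
    (h : θ < p) :
    (ovMeasure p n d).real {x | IsLight s θ (x i)} ≤ chernoff p θ ^ (s * s) := by
  rw [chernoff, div_pow, ← card_blocks hs hsd]
  refine le_trans (measureReal_mono (fun x hx => ?_) (measure_ne_top _ _))
    (measure_pow_ones_le i _ (Real.exp_pos _)
    (pow_pos (Real.exp_pos _) _))
  rw [card_blocks hs hsd]
  refine exp_le_exp_pow ?_
  have := IsLight.ones_le (show IsLight s θ (x i) from hx)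
  push_cast
  exact mul_le_mul_of_nonpos_left this (by linarith)

theorem one_add_mul_div_one_add (t : ℝ) :
    (1 + (p : ℝ) * t) / (1 + p) = 1 - p / (1 + p) + p / (1 + p) * t := by
  have := p.2.1
  field_simp
  ring

theorem measure_orth_lt_ones_le {i j : Fin n} (hij : i ≠ j) {s : ℕ} {A : Finset (Fin d)}
    (hA : A.card ≤ s) {θ : ℝ} (h : (p : ℝ) / (1 + p) < θ) :
    (ovMeasure p n d).real {x | Orth (x i) (x j) ∧ θ * s < ones (x i) A} ≤
      (1 - (p : ℝ) ^ 2) ^ d * chernoff (p / (1 + p)) θ ^ s := by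
  have hp := p.2.1
  have hq : 0 ≤ 1 - (p : ℝ) ^ 2 := by nlinarith [p.2.2]
  refine le_trans (measureReal_mono (fun x hx => ?_) (measure_ne_top _ _))
    ((measure_orth_pow_ones_le hij A (Real.exp_pos ((θ - p / (1 + p)) / 2))
      (pow_pos (Real.exp_pos ((θ - p / (1 + p)) / 2 * θ)) s)).trans ?_)
  · exact ⟨hx.1, exp_le_exp_pow (mul_le_mul_of_nonneg_left hx.2.le (by linarith))⟩
  · have ht1 : 1 ≤ Real.exp ((θ - p / (1 + p)) / 2) := Real.one_le_exp (by linarith)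
    -- The tilt exceeds 1, so the base is at least 1 and a set with fewer than `s` coordinates only
    -- helps.
    have hb : 1 ≤ 1 - p / (1 + p) + p / (1 + p) * Real.exp ((θ - p / (1 + p)) / 2) := by
      have := mul_le_mul_of_nonneg_left ht1 (show 0 ≤ (p : ℝ) / (1 + p) by positivity)
      linarith
    rw [one_add_mul_div_one_add, chernoff, div_pow _ _ s]
    refine mul_le_mul_of_nonneg_left (div_le_div_of_nonneg_right ?_ (by positivity)) (by positivity)
    exact pow_le_pow_right₀ hb hA

theorem measure_orth_not_isLight_le {i j : Fin n} (hij : i ≠ j) {s : ℕ} (hs : 0 < s) {θ : ℝ}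
    (h : (p : ℝ) / (1 + p) < θ) :
    (ovMeasure p n d).real {x | Orth (x i) (x j) ∧ ¬ IsLight s θ (x i)} ≤
      s * ((1 - (p : ℝ) ^ 2) ^ d * chernoff (p / (1 + p)) θ ^ s) := by
  have hA := fun c => measure_orth_lt_ones_le (p := p) hij (card_block_le (d := d) hs c) h
  have hU := measureReal_biUnion_le_card_mul (ovMeasure p n d) (Finset.range s)
    (fun c => {x | Orth (x i) (x j) ∧ θ * s < ones (x i) (block d s c)}) (N := s) (by simp)
    (measureReal_nonneg.trans (hA 0)) fun c _ => hA c
  refine le_trans (measureReal_mono (fun x hx => ?_) (measure_ne_top _ _)) hU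
  obtain ⟨ho, hl⟩ := hx
  simp only [IsLight, not_forall, not_le] at hl
  obtain ⟨c, hc, hlt⟩ := hl
  exact Set.mem_biUnion (Finset.mem_range.2 hc) ⟨ho, hlt⟩

theorem measure_orth_ones_lt_le {i j : Fin n} (hij : i ≠ j) {θ : ℝ} (h : θ < (p : ℝ) / (1 + p)) :
    (ovMeasure p n d).real {x | Orth (x i) (x j) ∧ ones (x i) Finset.univ < θ * d} ≤
      (1 - (p : ℝ) ^ 2) ^ d * chernoff (p / (1 + p)) θ ^ d := by
  refine le_trans (measureReal_mono (fun x hx => ?_) (measure_ne_top _ _))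
    ((measure_orth_pow_ones_le hij Finset.univ (Real.exp_pos ((θ - p / (1 + p)) / 2))
      (pow_pos (Real.exp_pos ((θ - p / (1 + p)) / 2 * θ)) d)).trans_eq ?_)
  · exact ⟨hx.1, exp_le_exp_pow (mul_le_mul_of_nonpos_left hx.2.le (by linarith))⟩
  · rw [one_add_mul_div_one_add, chernoff, div_pow _ _ d]
    simp

/-- The second partner must vanish on the ones of the shared vector, costing 1-p for each. The tilt
t = 1/(1-p) encodes this: 1-p+p(1-p)²t = 1-p². -/
theorem measure_two_orth_le {i j l : Fin n} (hij : i ≠ j) (hil : i ≠ l) (hjl : j ≠ l) {θ : ℝ}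
    (hp1 : (p : ℝ) < 1) :
    (ovMeasure p n d).real
        {x | Orth (x i) (x j) ∧ Orth (x i) (x l) ∧ θ * d ≤ ones (x i) Finset.univ} ≤
      (1 - (p : ℝ) ^ 2) ^ d * ((1 - (p : ℝ)) ^ θ) ^ d := by
  have hp := p.2.1
  have h1 : 0 < 1 - (p : ℝ) := by linarith
  refine le_trans (measureReal_mono (fun x hx => ?_) (measure_ne_top _ _))
    ((measure_two_orth_pow_ones_le hij hil hjl
    (inv_pos.2 h1) (T := ((((1 - (p : ℝ)) ^ θ)) ^ d)⁻¹) (by positivity)).trans_eq ?_)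
  · refine ⟨hx.1, hx.2.1, ?_⟩
    rw [inv_pow]
    gcongr
    rw [← Real.rpow_natCast, ← Real.rpow_natCast, ← Real.rpow_mul h1.le]
    exact Real.rpow_le_rpow_of_exponent_ge h1 (by linarith) hx.2.2
  · rw [div_inv_eq_mul]
    congr 2
    field_simp
    ring

end Light

/-! ### The search formula and its union-bound error. -/

section Search

variable {n d : ℕ} {p : unitInterval}

/-- The `c`-th group of `w` consecutive vectors among the first `m`. -/
def bucket (n m w c : ℕ) : Finset (Fin n) :=
  Finset.univ.filter fun i => i.val < m ∧ i.val / w = c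

theorem card_bucket_le {m w : ℕ} (hw : 0 < w) (c : ℕ) : (bucket n m w c).card ≤ w :=
  card_filter_div_le hw c

theorem disjoint_bucket {m w c c' : ℕ} (h : c ≠ c') :
    Disjoint (bucket n m w c) (bucket n m w c') := by
  refine Finset.disjoint_left.2 fun i hi hi' => h ?_
  rw [← (Finset.mem_filter.1 hi).2.2, ← (Finset.mem_filter.1 hi').2.2]

/-- The formula searching for orthogonal pairs of light vectors among the first `m` vectors, with
buckets of size `w`. -/
noncomputable def searchFormula (n d m w s : ℕ) (θ : ℝ) : BoolFormula (Fin n × Fin d) :=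
  BoolFormula.bucketFormula (BoolFormula.zeroInEach (heavySets d s θ))
    fun c : Fin (m / w + 1) => bucket n m w c

theorem output_zeroInEach_heavySets {s : ℕ} {θ : ℝ} (i : Fin n) (x : OVInstance n d) :
    (BoolFormula.zeroInEach (heavySets d s θ) i).output x = true ↔ IsLight s θ (x i) := by
  rw [BoolFormula.output_zeroInEach, forall_heavySets_iff]

theorem hasOrthogonalPair_of_output_searchFormula {m w s : ℕ} {θ : ℝ} (x : OVInstance n d)
    (h : (searchFormula n d m w s θ).output x = true) : x.HasOrthogonalPair :=
  BoolFormula.hasOrthogonalPair_of_output_bucketFormula _ _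
    (fun _ _ hc => disjoint_bucket (Fin.val_injective.ne hc)) x h

theorem depth_searchFormula_le {m w s : ℕ} {θ : ℝ} : (searchFormula n d m w s θ).depth ≤ 12 :=
  BoolFormula.depth_bucketFormula_le _ _ fun i => BoolFormula.depth_zeroInEach_le _ i

theorem size_searchFormula_le {m w s : ℕ} {θ : ℝ} (hw : 0 < w) (hs : 0 < s) {M : ℕ}
    (hM : s * 2 ^ s * (2 * s + 1) + 1 ≤ M) :
    (searchFormula n d m w s θ).size ≤
      (m / w + 1) ^ 2 * (2 * (w * M + 1) + d * (2 * (w * (M + 2) + 1) + 2) + 3) +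
        (m / w + 1) * (w ^ 2 * (4 * d + 1) + 1) + 3 := by
  refine BoolFormula.size_bucketFormula_le _ _ (fun i => le_trans ?_ hM)
    fun c => card_bucket_le hw c
  refine (BoolFormula.size_zeroInEach_le _ i fun T => card_le_of_mem_heavySets hs θ).trans ?_
  gcongr
  exact card_heavySets_le hs θ

theorem measure_orth_and (i j l : Fin n) (hij : i ≠ j) (hil : i ≠ l) (hjl : j ≠ l)
    (S : Set (Fin d → Bool)) :
    (ovMeasure p n d).real {x | Orth (x i) (x j) ∧ x l ∈ S} =
      (1 - (p : ℝ) ^ 2) ^ d * (ovMeasure p n d).real {x | x l ∈ S} := by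
  have h := (iIndepFun_vectors (p := p) (n := n) (d := d)).indepFun_prodMk
    (fun _ => measurable_pi_apply _) i j l hil hjl
  have h2 := h.measure_inter_preimage_eq_mul {uv | Orth uv.1 uv.2} S .of_discrete .of_discrete
  rw [← measure_orth (p := p) (d := d) hij]
  simp only [measureReal_def, ← ENNReal.toReal_mul]
  exact congrArg ENNReal.toReal h2

/-- A light orthogonal pair is missed only if a third light vector lies in one of its buckets. That
vector is independent of the pair, so the probabilities multiply; there are m² pairs and at most 2w
intruders for each. -/
theorem measure_missed_le {m w s : ℕ} {θ : ℝ} (hw : 0 < w) (hs : 0 < s)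
    (hsd : s * s ≤ d) (h : θ < p) :
    (ovMeasure p n d).real {x | ¬ (searchFormula n d m w s θ).output x = true ∧
        ∃ i j : Fin n, i ≠ j ∧ i.val < m ∧ j.val < m ∧ Orth (x i) (x j) ∧
          IsLight s θ (x i) ∧ IsLight s θ (x j)} ≤
      m * (m * ((2 * w : ℕ) * ((1 - (p : ℝ) ^ 2) ^ d * chernoff p θ ^ (s * s)))) := by
  classical
  have hp := p.2.1
  have hp1 := p.2.2
  have hq : 0 ≤ 1 - (p : ℝ) ^ 2 := by nlinarith
  have hch : 0 ≤ chernoff p θ := by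
    have : 0 ≤ 1 - (p : ℝ) := by linarith
    unfold chernoff; positivity
  have hcard : (Finset.univ.filter fun i : Fin n => i.val < m).card ≤ m := by
    refine (Finset.card_le_card_of_injOn (t := Finset.range m) Fin.val (fun i hi => ?_)
      Fin.val_injective.injOn).trans (by simp)
    simpa using hi
  refine le_trans (measureReal_mono (s₂ := ⋃ i ∈ Finset.univ.filter fun i : Fin n => i.val < m,
    ⋃ j ∈ Finset.univ.filter fun i : Fin n => i.val < m,
    ⋃ l ∈ bucket n m w (i.val / w) ∪ bucket n m w (j.val / w),
      {x | (i ≠ j ∧ i ≠ l ∧ j ≠ l) ∧ Orth (x i) (x j) ∧ IsLight s θ (x l)})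
    ?_ (measure_ne_top _ _)) ?_
  · rintro x ⟨hF, i, j, hij, hi, hj, ho, hLi, hLj⟩
    by_contra hx
    simp only [Set.mem_iUnion, Finset.mem_filter, Finset.mem_univ, true_and, Finset.mem_union,
      Set.mem_ofPred_eq, not_exists, exists_prop, not_and] at hx
    have hlt : ∀ i < m, i / w < m / w + 1 := fun i hi =>
      Nat.lt_succ_of_le (Nat.div_le_div_right hi.le)
    have hmem : ∀ i : Fin n, i.val < m → i ∈ bucket n m w (i.val / w) := fun i hi => by
      simp [bucket, hi]
    refine hF (BoolFormula.output_bucketFormula_of_isolated _ _ x hij ho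
      (c := ⟨i.val / w, hlt _ hi⟩) (c' := ⟨j.val / w, hlt _ hj⟩) (hmem i hi) (hmem j hj)
      ((output_zeroInEach_heavySets i x).2 hLi) ((output_zeroInEach_heavySets j x).2 hLj)
      ?_ ?_ fun _ _ hc => disjoint_bucket (Fin.val_injective.ne hc))
    · intro l hl hli hlj
      rw [output_zeroInEach_heavySets]
      exact hx i hi j hj l (.inl hl) ⟨hij, hli.symm, hlj.symm⟩ ho
    · intro l hl hli hlj
      rw [output_zeroInEach_heavySets]
      exact hx i hi j hj l (.inr hl) ⟨hij, hli.symm, hlj.symm⟩ ho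
  · refine measureReal_biUnion_le_card_mul _ _ _ hcard (by positivity) fun i _ =>
      measureReal_biUnion_le_card_mul _ _ _ hcard (by positivity) fun j _ =>
      measureReal_biUnion_le_card_mul _ _ _ ?_ (by positivity) fun l _ => ?_
    · refine (Finset.card_union_le _ _).trans ?_
      have h1 := card_bucket_le (n := n) (m := m) hw (i.val / w)
      have h2 := card_bucket_le (n := n) (m := m) hw (j.val / w)
      omega
    · by_cases hne : i ≠ j ∧ i ≠ l ∧ j ≠ l
      · refine (measureReal_mono (fun x hx => hx.2) (measure_ne_top _ _)).trans
          ((measure_orth_and i j l hne.1 hne.2.1 hne.2.2 {u | IsLight s θ u}).trans_le ?_)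
        exact mul_le_mul_of_nonneg_left (measure_isLight_le l hs hsd h) (by positivity)
      · simp only [hne, false_and]
        simp only [Set.ofPred_false, measureReal_empty]
        positivity

theorem measure_exists_orth_not_isLight_le {s : ℕ} (hs : 0 < s) {θ : ℝ}
    (h : (p : ℝ) / (1 + p) < θ) :
    (ovMeasure p n d).real {x | ∃ i j : Fin n, i ≠ j ∧ Orth (x i) (x j) ∧ ¬ IsLight s θ (x i)} ≤
      n * (n * (s * ((1 - (p : ℝ) ^ 2) ^ d * chernoff (p / (1 + p)) θ ^ s))) := by
  have hp := p.2.1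
  have hp1 := p.2.2
  have hq : 0 ≤ 1 - (p : ℝ) ^ 2 := by nlinarith
  have hch : 0 ≤ chernoff (p / (1 + p)) θ := by
    have : 0 ≤ 1 - (p : ℝ) / (1 + p) := by
      rw [sub_nonneg, div_le_one (by positivity)]; linarith
    unfold chernoff; positivity
  refine le_trans (measureReal_mono (s₂ := ⋃ i ∈ (Finset.univ : Finset (Fin n)),
    ⋃ j ∈ (Finset.univ : Finset (Fin n)),
      {x | i ≠ j ∧ Orth (x i) (x j) ∧ ¬ IsLight s θ (x i)}) ?_ (measure_ne_top _ _)) ?_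
  · rintro x ⟨i, j, hx⟩
    simp only [Set.mem_iUnion]
    exact ⟨i, Finset.mem_univ _, j, Finset.mem_univ _, hx⟩
  · refine measureReal_biUnion_le_card_mul _ _ _ (by simp) (by positivity) fun i _ =>
      measureReal_biUnion_le_card_mul _ _ _ (by simp) (by positivity) fun j _ => ?_
    by_cases hij : i ≠ j
    · simpa [hij] using measure_orth_not_isLight_le (p := p) (d := d) hij hs h
    · simp only [hij, false_and]
      simp only [Set.ofPred_false, measureReal_empty]
      positivity

theorem measure_hasOrthogonalPair_le :
    (ovMeasure p n d).real {x | x.HasOrthogonalPair} ≤ n * (n * (1 - (p : ℝ) ^ 2) ^ d) := by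
  have hp := p.2.1
  have hp1 := p.2.2
  have hq : 0 ≤ 1 - (p : ℝ) ^ 2 := by nlinarith
  refine le_trans (measureReal_mono (s₂ := ⋃ i ∈ (Finset.univ : Finset (Fin n)),
    ⋃ j ∈ (Finset.univ : Finset (Fin n)), {x | i ≠ j ∧ Orth (x i) (x j)})
    ?_ (measure_ne_top _ _)) ?_
  · intro x hx
    obtain ⟨i, j, hx⟩ := x.hasOrthogonalPair_iff.1 hx
    simp only [Set.mem_iUnion]
    exact ⟨i, Finset.mem_univ _, j, Finset.mem_univ _, hx⟩
  · refine measureReal_biUnion_le_card_mul _ _ _ (by simp) (by positivity) fun i _ =>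
      measureReal_biUnion_le_card_mul _ _ _ (by simp) (by positivity) fun j _ => ?_
    by_cases hij : i ≠ j
    · simpa [hij] using (measure_orth (p := p) (d := d) hij).le
    · simp only [hij, false_and]
      simp only [Set.ofPred_false, measureReal_empty]
      positivity

theorem searchFormula_error_le_of_full {w s : ℕ} {θ : ℝ} (hw : 0 < w) (hs : 0 < s)
    (hsd : s * s ≤ d) (h : θ < p) (h' : (p : ℝ) / (1 + p) < θ) :
    (ovMeasure p n d).real {x | ¬ ((searchFormula n d n w s θ).output x = true ↔
        x.HasOrthogonalPair)} ≤
      n ^ 2 * (1 - (p : ℝ) ^ 2) ^ d *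
        (2 * s * chernoff (p / (1 + p)) θ ^ s + 2 * w * chernoff p θ ^ (s * s)) := by
  have h1 := measure_exists_orth_not_isLight_le (p := p) (n := n) (d := d) hs h'
  have h2 := measure_missed_le (p := p) (n := n) (m := n) (w := w) hw hs hsd h
  refine le_trans (measureReal_mono ?_ (measure_ne_top _ _))
    ((measureReal_union_le _ _).trans (add_le_add h1 h2) |>.trans ?_)
  · intro x hx
    by_cases hF : (searchFormula n d n w s θ).output x = true
    · exact absurd (iff_of_true hF (hasOrthogonalPair_of_output_searchFormula x hF)) hx
    have hy : x.HasOrthogonalPair := by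
      by_contra hy
      exact hx (iff_of_false hF hy)
    obtain ⟨i, j, hij, ho⟩ := x.hasOrthogonalPair_iff.1 hy
    by_cases hi : IsLight s θ (x i)
    · by_cases hj : IsLight s θ (x j)
      · exact .inr ⟨hF, i, j, hij, i.2, j.2, ho, hi, hj⟩
      · exact .inl ⟨j, i, hij.symm, ho.symm, hj⟩
    · exact .inl ⟨i, j, hij, ho, hi⟩
  · have hp := p.2.1
    have hp1 := p.2.2
    have hq : 0 ≤ 1 - (p : ℝ) ^ 2 := by nlinarith
    have hch : 0 ≤ chernoff (p / (1 + p)) θ := by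
      have : 0 ≤ 1 - (p : ℝ) / (1 + p) := by
        rw [sub_nonneg, div_le_one (by positivity)]; linarith
      unfold chernoff; positivity
    have : 0 ≤ n ^ 2 * (1 - (p : ℝ) ^ 2) ^ d * (s * chernoff (p / (1 + p)) θ ^ s) := by positivity
    push_cast
    linarith

end Search

/-! ### Existence of a light orthogonal pair by the second moment method. -/

section SecondMoment

variable {n d : ℕ} {p : unitInterval}

/-- Orthogonal light vectors that have at least `θ' * d` ones each. -/
def TypicalPair {d : ℕ} (s : ℕ) (θ θ' : ℝ) (u v : Fin d → Bool) : Prop :=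
  Orth u v ∧ (IsLight s θ u ∧ θ' * d ≤ ones u Finset.univ) ∧
    (IsLight s θ v ∧ θ' * d ≤ ones v Finset.univ)

/-- θ' and θ enclose the conditional density p/(1+p), so each vector of an orthogonal pair is
atypical with conditional probability at most 1/4. -/
theorem measure_typicalPair_ge {i j : Fin n} (hij : i ≠ j) {s : ℕ} (hs : 0 < s) {θ θ' : ℝ}
    (hθ : (p : ℝ) / (1 + p) < θ) (hθ' : θ' < (p : ℝ) / (1 + p))
    (hsmall : s * chernoff (p / (1 + p)) θ ^ s + chernoff (p / (1 + p)) θ' ^ d ≤ 1 / 4) :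
    (1 - (p : ℝ) ^ 2) ^ d / 2 ≤
      (ovMeasure p n d).real {x | TypicalPair s θ θ' (x i) (x j)} := by
  have hp := p.2.1
  have hp1 := p.2.2
  have hq : 0 ≤ (1 - (p : ℝ) ^ 2) ^ d := pow_nonneg (by nlinarith) d
  set P := (ovMeasure p n d).real
  set B : Fin n → Fin n → Set (OVInstance n d) := fun i j =>
    {x | Orth (x i) (x j) ∧ ¬ IsLight s θ (x i)} ∪
      {x | Orth (x i) (x j) ∧ ones (x i) Finset.univ < θ' * d}
  have hB : ∀ i j, i ≠ j → P (B i j) ≤ (1 - (p : ℝ) ^ 2) ^ d / 4 := fun i j hij => by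
    have h1 := measure_orth_not_isLight_le (p := p) (d := d) hij hs hθ
    have h2 := measure_orth_ones_lt_le (p := p) (d := d) hij hθ'
    refine (measureReal_union_le _ _).trans ((add_le_add h1 h2).trans ?_)
    have := mul_le_mul_of_nonneg_left hsmall hq
    linarith
  have hsub : {x : OVInstance n d | Orth (x i) (x j)} ⊆
      {x | TypicalPair s θ θ' (x i) (x j)} ∪ (B i j ∪ B j i) := by
    intro x hx
    have ho : Orth (x i) (x j) := hx
    by_contra hcon
    simp only [B, TypicalPair, Set.mem_union, Set.mem_ofPred_eq, ho, ho.symm, true_and] at hcon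
    grind
  have h1 := (measureReal_mono (μ := ovMeasure p n d) hsub (measure_ne_top _ _)).trans
    ((measureReal_union_le _ _).trans (add_le_add_right (measureReal_union_le _ _) _))
  rw [measure_orth hij] at h1
  linarith [hB i j hij, hB j i hij.symm]

theorem measure_typicalPair_inter_disjoint {i j k l : Fin n} (hik : i ≠ k) (hil : i ≠ l)
    (hjk : j ≠ k) (hjl : j ≠ l) {s : ℕ} {θ θ' : ℝ} :
    (ovMeasure p n d).real ({x | TypicalPair s θ θ' (x i) (x j)} ∩
        {x | TypicalPair s θ θ' (x k) (x l)}) =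
      (ovMeasure p n d).real {x | TypicalPair s θ θ' (x i) (x j)} *
        (ovMeasure p n d).real {x | TypicalPair s θ θ' (x k) (x l)} := by
  have h := (iIndepFun_vectors (p := p) (n := n) (d := d)).indepFun_prodMk_prodMk
    (fun _ => measurable_pi_apply _) i j k l hik hil hjk hjl
  have h2 := h.measure_inter_preimage_eq_mul {uv | TypicalPair s θ θ' uv.1 uv.2}
    {uv | TypicalPair s θ θ' uv.1 uv.2} .of_discrete .of_discrete
  simp only [measureReal_def, ← ENNReal.toReal_mul]
  exact congrArg ENNReal.toReal h2

theorem measure_no_typicalPair_le {h s : ℕ} {θ θ' : ℝ} (hh : 0 < h) (hn : 2 * h ≤ n) (hs : 0 < s)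
    (hp1 : (p : ℝ) < 1) (hθ : (p : ℝ) / (1 + p) < θ) (hθ' : θ' < (p : ℝ) / (1 + p))
    (hsmall : s * chernoff (p / (1 + p)) θ ^ s + chernoff (p / (1 + p)) θ' ^ d ≤ 1 / 4)
    (hσ : (1 - (p : ℝ)) ^ θ' ≤ √(1 - (p : ℝ) ^ 2)) :
    (ovMeasure p n d).real {x | ∀ i j : Fin n, i ≠ j → i.val < 2 * h → j.val < 2 * h →
        ¬ TypicalPair s θ θ' (x i) (x j)} ≤
      8 / (h * √(1 - (p : ℝ) ^ 2) ^ d) + 4 / (h * √(1 - (p : ℝ) ^ 2) ^ d) ^ 2 := by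
  have hp := p.2.1
  have hpp : 0 < 1 - (p : ℝ) ^ 2 := by nlinarith
  set P := (ovMeasure p n d).real with hPdef
  obtain ⟨r, hr⟩ : ∃ r, r = √(1 - (p : ℝ) ^ 2) ^ d := ⟨_, rfl⟩
  have hr0 : 0 < r := by rw [hr]; positivity
  have hrq : (1 - (p : ℝ) ^ 2) ^ d = r ^ 2 := by
    rw [hr, ← pow_mul, mul_comm d, pow_mul, Real.sq_sqrt hpp.le]
  -- Only pairs between two disjoint halves are counted, so two distinct pairs share at most one
  -- vector, on a known side.
  let L : Fin h → Fin n := fun a => ⟨a.val, by omega⟩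
  let R : Fin h → Fin n := fun b => ⟨h + b.val, by omega⟩
  have hL : ∀ a a', a ≠ a' → L a ≠ L a' := fun a a' hne he => hne (Fin.ext (by simpa [L] using he))
  have hR : ∀ a a', a ≠ a' → R a ≠ R a' := fun a a' hne he => hne (Fin.ext (by simpa [R] using he))
  have hLR : ∀ a b, L a ≠ R b := fun a b he => by simp [L, R] at he; omega
  let A : Fin h × Fin h → Set (OVInstance n d) := fun c =>
    {x | TypicalPair s θ θ' (x (L c.1)) (x (R c.2))}
  have hAle : ∀ c, P (A c) ≤ r ^ 2 := fun c => by
    rw [← hrq, ← measure_orth (p := p) (d := d) (hLR c.1 c.2)]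
    exact measureReal_mono (fun x hx => hx.1) (measure_ne_top _ _)
  have hAge : ∀ c, r ^ 2 / 2 ≤ P (A c) := fun c => by
    rw [← hrq]
    exact measure_typicalPair_ge (hLR c.1 c.2) hs hθ hθ' hsmall
  have hstar : ∀ i j l : Fin n, i ≠ j → i ≠ l → j ≠ l → P {x | Orth (x i) (x j) ∧
      Orth (x i) (x l) ∧ θ' * d ≤ ones (x i) Finset.univ} ≤ r ^ 3 := fun i j l hij hil hjl => by
    refine (measure_two_orth_le hij hil hjl hp1).trans ?_
    rw [hrq, pow_succ r 2, hr]
    gcongr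
  -- Disjoint pairs are independent; pairs with a common vector are stars, contributing r³ by the
  -- choice of θ'; equal pairs contribute r².
  have hcov : ∀ c c', P (A c ∩ A c') - P (A c) * P (A c') ≤
      (if c.1 = c'.1 then r ^ 3 else 0) + (if c.2 = c'.2 then r ^ 3 else 0) +
        if c = c' then r ^ 2 else 0 := by
    rintro ⟨a, b⟩ ⟨a', b'⟩
    have hnn : 0 ≤ P (A (a, b)) * P (A (a', b')) := mul_nonneg measureReal_nonneg measureReal_nonneg
    have h3 : 0 ≤ r ^ 3 := by positivity
    by_cases ha : a = a'
    · subst ha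
      by_cases hb : b = b'
      · subst hb
        simp only [Set.inter_self, if_true]
        linarith [hAle (a, b)]
      · have : P (A (a, b) ∩ A (a, b')) ≤ r ^ 3 :=
          (hstar (L a) (R b) (R b') (hLR _ _) (hLR _ _) (hR _ _ hb)).trans'
            (measureReal_mono (fun x hx => ⟨hx.1.1, hx.2.1, hx.1.2.1.2⟩) (measure_ne_top _ _))
        simp [hb]
        linarith
    · by_cases hb : b = b'
      · subst hb
        have : P (A (a, b) ∩ A (a', b)) ≤ r ^ 3 :=
          (hstar (R b) (L a) (L a') (hLR _ _).symm (hLR _ _).symm (hL _ _ ha)).trans'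
            (measureReal_mono (fun x hx => ⟨hx.1.1.symm, hx.2.1.symm, hx.1.2.2.2⟩)
              (measure_ne_top _ _))
        simp [ha]
        linarith
      · have := measure_typicalPair_inter_disjoint (p := p) (d := d) (s := s) (θ := θ) (θ' := θ')
          (hL _ _ ha) (hLR a b') (hLR a' b).symm (hR _ _ hb)
        have h0 : P (A (a, b) ∩ A (a', b')) = P (A (a, b)) * P (A (a', b')) := this
        simp [ha, hb, h0]
  have hsum : ∑ c, ∑ c', P (A c ∩ A c') - (∑ c, P (A c)) ^ 2 ≤
      2 * h ^ 3 * r ^ 3 + h ^ 2 * r ^ 2 := by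
    rw [sq, Finset.sum_mul_sum, ← Finset.sum_sub_distrib]
    simp only [← Finset.sum_sub_distrib]
    refine (Finset.sum_le_sum fun c _ => Finset.sum_le_sum fun c' _ => hcov c c').trans_eq ?_
    simp only [Finset.sum_add_distrib, Fintype.sum_prod_type, Prod.mk.injEq]
    have hconst : ∀ x : Fin h, ∑ y : Fin h, ∑ _z : Fin h, (if x = y then r ^ 3 else 0) =
        h * r ^ 3 := fun x => by
      rw [Finset.sum_comm]
      simp
    simp [hconst, ite_and]
    ring
  have hM : h ^ 2 * (r ^ 2 / 2) ≤ ∑ c, P (A c) := by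
    have := Finset.card_nsmul_le_sum Finset.univ (fun c => P (A c)) _ fun c _ => hAge c
    simpa [sq] using this
  have h2 := (second_moment (ovMeasure p n d) A).trans hsum
  have hle : P {x | ∀ i j : Fin n, i ≠ j → i.val < 2 * h → j.val < 2 * h →
        ¬ TypicalPair s θ θ' (x i) (x j)} ≤ P {x | ∀ c, x ∉ A c} :=
    measureReal_mono (fun x hx c => hx _ _ (hLR c.1 c.2) (by simp [L]; omega) (by simp [R]; omega))
      (measure_ne_top _ _)
  have hh' : (0 : ℝ) < h := by exact_mod_cast hh
  have h3 : P {x | ∀ c, x ∉ A c} * (h ^ 2 * (r ^ 2 / 2)) ^ 2 ≤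
      2 * h ^ 3 * r ^ 3 + h ^ 2 * r ^ 2 := by
    refine le_trans ?_ h2
    gcongr
  rw [← hr]
  refine hle.trans ?_
  rw [← le_div_iff₀ (by positivity)] at h3
  refine h3.trans_eq ?_
  field_simp
  ring

theorem searchFormula_error_le_of_many {m w s : ℕ} {θ θ' : ℝ} (hm : 2 ≤ m) (hmn : m ≤ n)
    (hw : 0 < w) (hs : 0 < s) (hsd : s * s ≤ d) (hp1 : (p : ℝ) < 1)
    (hθp : θ < p) (hθ : (p : ℝ) / (1 + p) < θ) (hθ' : θ' < (p : ℝ) / (1 + p))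
    (hsmall : s * chernoff (p / (1 + p)) θ ^ s + chernoff (p / (1 + p)) θ' ^ d ≤ 1 / 4)
    (hσ : (1 - (p : ℝ)) ^ θ' ≤ √(1 - (p : ℝ) ^ 2)) :
    (ovMeasure p n d).real {x | ¬ ((searchFormula n d m w s θ).output x = true ↔
        x.HasOrthogonalPair)} ≤
      8 / ((m / 2 : ℕ) * √(1 - (p : ℝ) ^ 2) ^ d) +
        4 / ((m / 2 : ℕ) * √(1 - (p : ℝ) ^ 2) ^ d) ^ 2 +
        m ^ 2 * (1 - (p : ℝ) ^ 2) ^ d * (2 * w * chernoff p θ ^ (s * s)) := by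
  have h1 := measure_no_typicalPair_le (p := p) (d := d) (n := n) (h := m / 2) (by omega)
    (by omega) hs hp1 hθ hθ' hsmall hσ
  have h2 := measure_missed_le (p := p) (n := n) (m := m) (w := w) hw hs hsd hθp
  refine le_trans (measureReal_mono ?_ (measure_ne_top _ _))
    ((measureReal_union_le _ _).trans (add_le_add h1 h2) |>.trans ?_)
  · intro x hx
    by_cases hF : (searchFormula n d m w s θ).output x = true
    · exact absurd (iff_of_true hF (hasOrthogonalPair_of_output_searchFormula x hF)) hx
    by_contra hcon
    simp only [Set.mem_union, not_or, Set.mem_ofPred_eq, not_forall, not_not] at hcon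
    obtain ⟨⟨i, j, hij, hi, hj, ht⟩, h⟩ := hcon
    exact h ⟨hF, i, j, hij, by omega, by omega, ht.1, ht.2.1.1, ht.2.2.1⟩
  · push_cast
    linarith

end SecondMoment

/-! ### The sparse and dense ranges, and the size of the search formula. -/

section Asymptotics

/-- Some sound formula of depth at most 12 and size at most `S` errs with probability at most
`e`. -/
def Solvable (p : unitInterval) (n d : ℕ) (S e : ℝ) : Prop :=
  ∃ F : BoolFormula (Fin n × Fin d), F.depth ≤ 12 ∧ (F.size : ℝ) ≤ S ∧
    (∀ x : OVInstance n d, F.output x = true → x.HasOrthogonalPair) ∧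
    (ovMeasure p n d).real {x | ¬ (F.output x = true ↔ x.HasOrthogonalPair)} ≤ e

variable {p : unitInterval}

theorem Solvable.mono {n d : ℕ} {S S' e e' : ℝ} (h : Solvable p n d S e) (hS : S ≤ S')
    (he : e ≤ e') : Solvable p n d S' e' := by
  obtain ⟨F, h1, h2, h3, h4⟩ := h
  exact ⟨F, h1, h2.trans hS, h3, h4.trans he⟩

theorem solvable_const_false (n d : ℕ) :
    Solvable p n d 1 ((ovMeasure p n d).real {x | x.HasOrthogonalPair}) := by
  refine ⟨.const false, by simp [BoolFormula.depth], by simp [BoolFormula.size], ?_, ?_⟩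
  · intro x hx
    simp [BoolFormula.output, BoolFormula.eval] at hx
  · simp [BoolFormula.output, BoolFormula.eval]

theorem eventually_log_natCast {P : ℝ → Prop} (h : ∀ᶠ L in atTop, P L) :
    ∀ᶠ n : ℕ in atTop, P (Real.log n) :=
  (Real.tendsto_log_atTop.comp tendsto_natCast_atTop_atTop).eventually h

theorem solvable_of_sparse (hp1 : (p : ℝ) < 1) {n d : ℕ} (hn : 1 ≤ n)
    (h : 3 * Real.log n ≤ -Real.log (1 - (p : ℝ) ^ 2) * d) : Solvable p n d 1 (1 / n) := by
  have hp := p.2.1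
  have hpp : 0 < 1 - (p : ℝ) ^ 2 := by nlinarith
  have hn0 : (0 : ℝ) < n := by exact_mod_cast hn
  refine (solvable_const_false n d).mono le_rfl (measure_hasOrthogonalPair_le.trans ?_)
  have h1 : (1 - (p : ℝ) ^ 2) ^ d ≤ (1 / n) ^ 3 := by
    rw [← Real.log_le_log_iff (by positivity) (by positivity), Real.log_pow, Real.log_pow,
      one_div, Real.log_inv]
    push_cast
    linarith
  calc (n : ℝ) * (n * (1 - (p : ℝ) ^ 2) ^ d) ≤ (n : ℝ) * (n * (1 / n) ^ 3) := by gcongr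
    _ = 1 / (n : ℝ) := by field_simp

/-- Since 2^d ≤ e^d ≤ n^a, the slack n^{b-a} absorbs the factors linear in d. -/
theorem eventually_solvable_of_dense {a b : ℝ} (hab : a < b) :
    ∀ᶠ n : ℕ in atTop, ∀ d : ℕ, (d : ℝ) ≤ a * Real.log n →
      Solvable p n d ((n : ℝ) ^ (1 + b)) 0 := by
  have hlim : ∀ᶠ L : ℝ in atTop, 4 * a * L + 6 ≤ Real.exp ((b - a) * L) := by
    have hba : 0 < b - a := by linarith
    filter_upwards [eventually_ge_atTop ((4 * a + 6) * 2 / (b - a) ^ 2), eventually_ge_atTop 1]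
      with L hL hL1
    have h1 := Real.quadratic_le_exp_of_nonneg (show 0 ≤ (b - a) * L by positivity)
    rw [div_le_iff₀ (by positivity)] at hL
    have h2 : (4 * a + 6) * 2 * L ≤ L * (b - a) ^ 2 * L := by gcongr
    have h3 : 0 ≤ (b - a) * L := by positivity
    nlinarith
  filter_upwards [eventually_log_natCast hlim, eventually_ge_atTop 2] with n hn hn2 d hd
  have hn0 : (0 : ℝ) < n := by positivity
  have hn1 : (1 : ℝ) ≤ n := by exact_mod_cast (by omega : 1 ≤ n)
  refine ⟨BoolFormula.exhaustive n d, BoolFormula.depth_exhaustive_le.trans (by norm_num), ?_,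
    fun x => (BoolFormula.output_exhaustive hn2 x).1, ?_⟩
  · have h1 : ((BoolFormula.exhaustive n d).size : ℝ) ≤
        2 ^ d * (2 * (n * (2 * d + 1) + 1) + 1) + 1 := by
      exact_mod_cast BoolFormula.size_exhaustive_le
    have h2 : (2 : ℝ) ^ d ≤ Real.exp (a * Real.log n) := by
      calc (2 : ℝ) ^ d ≤ Real.exp 1 ^ d := by
            gcongr
            linarith [Real.add_one_le_exp 1]
        _ = Real.exp d := by rw [← Real.exp_nat_mul, mul_one]
        _ ≤ _ := Real.exp_le_exp.2 hd
    have h3 : (1 : ℝ) ≤ 2 ^ d := one_le_pow₀ (by norm_num)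
    calc _ ≤ (2 : ℝ) ^ d * (2 * (n * (2 * d + 1) + 1) + 1) + 1 := h1
      _ ≤ (2 : ℝ) ^ d * (n * (4 * d + 6)) := by
          have h4 : (2 : ℝ) ^ d * 1 ≤ 2 ^ d * n := by gcongr
          nlinarith
      _ ≤ Real.exp (a * Real.log n) * (n * Real.exp ((b - a) * Real.log n)) := by
          gcongr
          linarith
      _ = (n : ℝ) ^ (1 + b) := by
          rw [Real.rpow_def_of_pos hn0]
          nth_rw 2 [← Real.exp_log hn0]
          rw [← Real.exp_add, ← Real.exp_add]
          ring_nf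
  · exact (measureReal_mono (s₂ := ∅)
      (fun x hx => absurd (BoolFormula.output_exhaustive hn2 x) hx)
      (measure_ne_top _ _)).trans (by simp)

theorem size_searchFormula_real_le {n d m w s : ℕ} {θ : ℝ} (hw : 0 < w) (hs : 0 < s)
    (hsd : s * s ≤ d) :
    ((searchFormula n d m w s θ).size : ℝ) ≤
      ((m / w : ℝ) + 1) ^ 2 * w * (((3 * d + 1) * 2 ^ s) * (10 * d + 7)) +
        ((m / w : ℝ) + 1) * w ^ 2 * (4 * d + 2) + 3 := by
  have hsd' : s ≤ d := (Nat.le_mul_self s).trans hsd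
  have hM : s * 2 ^ s * (2 * s + 1) + 1 ≤ (3 * d + 1) * 2 ^ s := by
    have : 1 ≤ 2 ^ s := Nat.one_le_two_pow
    nlinarith
  have h := size_searchFormula_le (n := n) (d := d) (m := m) (θ := θ) hw hs hM
  set M := (3 * d + 1) * 2 ^ s with hMdef
  have hM1 : 1 ≤ M := by omega
  have hwM : 1 ≤ w * M := Nat.mul_pos hw hM1
  have hwM' : w ≤ w * M := Nat.le_mul_of_pos_right _ hM1
  have h1 : 2 * (w * M + 1) + d * (2 * (w * (M + 2) + 1) + 2) + 3 ≤ w * M * (10 * d + 7) := by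
    nlinarith
  have h2 : w ^ 2 * (4 * d + 1) + 1 ≤ w ^ 2 * (4 * d + 2) := by
    have : 1 ≤ w ^ 2 := Nat.one_le_pow _ _ hw
    nlinarith
  have h3 : (searchFormula n d m w s θ).size ≤
      (m / w + 1) ^ 2 * (w * M * (10 * d + 7)) + (m / w + 1) * (w ^ 2 * (4 * d + 2)) + 3 := by
    refine h.trans ?_
    gcongr
  have hb : ((m / w : ℕ) : ℝ) ≤ m / w := Nat.cast_div_le
  have h4 : ((searchFormula n d m w s θ).size : ℝ) ≤
      (((m / w : ℕ) : ℝ) + 1) ^ 2 * (w * M * (10 * d + 7)) +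
        (((m / w : ℕ) : ℝ) + 1) * (w ^ 2 * (4 * d + 2)) + 3 := by exact_mod_cast h3
  have hMr : (M : ℝ) = (3 * d + 1) * 2 ^ s := by rw [hMdef]; push_cast; ring
  rw [← hMr]
  calc _ ≤ _ := h4
    _ ≤ ((m / w : ℝ) + 1) ^ 2 * (w * M * (10 * d + 7)) +
        ((m / w : ℝ) + 1) * (w ^ 2 * (4 * d + 2)) + 3 := by gcongr
    _ = _ := by ring

/-- The main term is n²/n^η, and the factors depending on d and s amount to e^{O(√log n)}, which
half of the saving pays for. -/
theorem eventually_size_searchFormula_le {C η : ℝ} (hC : 0 ≤ C) (hη : 0 < η) (hη4 : η ≤ 1 / 4) :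
    ∀ᶠ n : ℕ in atTop, ∀ (d m s w : ℕ) (θ : ℝ), 0 < s → s * s ≤ d → (d : ℝ) ≤ C * Real.log n →
      w = ⌈(n : ℝ) ^ η⌉₊ → m ≤ n →
      ((searchFormula n d m w s θ).size : ℝ) ≤ (n : ℝ) ^ (2 - η / 2) := by
  have hlim : ∀ᶠ L : ℝ in atTop, 6 + 5 * √(C * L) ≤ η / 2 * L := by
    filter_upwards [(Real.tendsto_sqrt_atTop).eventually_ge_atTop (2 / η * (6 + 5 * √C)),
      (Real.tendsto_sqrt_atTop).eventually_ge_atTop 1, eventually_ge_atTop 0] with L h1 h2 h3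
    rw [Real.sqrt_mul hC]
    have h4 : L = √L * √L := (Real.mul_self_sqrt h3).symm
    have h5 : 6 + 5 * √C ≤ η / 2 * √L := by
      calc 6 + 5 * √C = η / 2 * (2 / η * (6 + 5 * √C)) := by field_simp
        _ ≤ _ := by gcongr
    calc 6 + 5 * (√C * √L) ≤ (6 + 5 * √C) * √L := by linarith
      _ ≤ η / 2 * √L * √L := by gcongr
      _ = η / 2 * L := by rw [mul_assoc, ← h4]
  filter_upwards [eventually_log_natCast hlim, eventually_ge_atTop 1]
    with n hn hn1 d m s w θ hs hsd hd hw hm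
  have hn1' : (1 : ℝ) ≤ n := by exact_mod_cast hn1
  have hn0 : (0 : ℝ) < n := by linarith
  set N := (n : ℝ) ^ η with hN
  have hN1 : 1 ≤ N := Real.one_le_rpow hn1' hη.le
  have hN0 : 0 < N := by linarith
  have hwl : N ≤ w := hw ▸ Nat.le_ceil _
  have hwu : (w : ℝ) ≤ 2 * N := by
    rw [hw]
    linarith [(Nat.ceil_lt_add_one hN0.le).le]
  have hw0 : 0 < w := by
    have : (0 : ℝ) < w := by linarith
    exact_mod_cast this
  have hNn : N ≤ n := by
    calc N ≤ (n : ℝ) ^ (1 : ℝ) := Real.rpow_le_rpow_of_exponent_le hn1' (by linarith)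
      _ = n := Real.rpow_one _
  have hb : (m / w : ℝ) + 1 ≤ 2 * (n / N) := by
    have h1 : (m / w : ℝ) ≤ n / N := by gcongr
    have h2 : 1 ≤ n / N := (one_le_div hN0).2 hNn
    linarith
  have hN3 : N ^ 2 ≤ n := by
    rw [hN, ← Real.rpow_natCast, ← Real.rpow_mul hn0.le]
    calc _ ≤ (n : ℝ) ^ (1 : ℝ) := Real.rpow_le_rpow_of_exponent_le hn1' (by push_cast; linarith)
      _ = n := Real.rpow_one _
  have hsqrt : (s : ℝ) ≤ √d := Real.le_sqrt_of_sq_le (by rw [sq]; exact_mod_cast hsd)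
  have hd1 : (d : ℝ) + 1 ≤ Real.exp (2 * √d) := by
    have h1 := Real.add_one_le_exp √d
    have h2 : (d : ℝ) + 1 ≤ (√d + 1) ^ 2 := by
      have := Real.sq_sqrt (Nat.cast_nonneg (α := ℝ) d)
      nlinarith [Real.sqrt_nonneg d]
    calc (d : ℝ) + 1 ≤ (√d + 1) ^ 2 := h2
      _ ≤ Real.exp √d ^ 2 := by gcongr
      _ = _ := by rw [← Real.exp_nat_mul]; norm_num
  have h2s : (2 : ℝ) ^ s ≤ Real.exp √d := by
    calc (2 : ℝ) ^ s ≤ Real.exp 1 ^ s := by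
          gcongr
          linarith [Real.add_one_le_exp 1]
      _ = Real.exp s := by rw [← Real.exp_nat_mul, mul_one]
      _ ≤ _ := Real.exp_le_exp.2 hsqrt
  have h2s1 : (1 : ℝ) ≤ 2 ^ s := one_le_pow₀ (by norm_num)
  have hd0 : (0 : ℝ) ≤ d := Nat.cast_nonneg d
  -- The tests inside buckets cost about nN; since N² ≤ n this stays below the cross tests.
  have hnN : n * N ≤ n ^ 2 / N := by
    rw [le_div_iff₀ hN0]
    nlinarith
  have hnN1 : 1 ≤ n ^ 2 / N := by
    rw [le_div_iff₀ hN0]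
    nlinarith
  have h336 : (336 : ℝ) ≤ Real.exp 6 := by
    have h1 := Real.exp_one_gt_d9
    have h2 : Real.exp 6 = Real.exp 1 ^ 6 := by rw [← Real.exp_nat_mul]; norm_num
    rw [h2]
    calc (336 : ℝ) ≤ 2.7182818283 ^ 6 := by norm_num
      _ ≤ _ := by gcongr
  calc _ ≤ ((m / w : ℝ) + 1) ^ 2 * w * (((3 * d + 1) * 2 ^ s) * (10 * d + 7)) +
        ((m / w : ℝ) + 1) * w ^ 2 * (4 * d + 2) + 3 := size_searchFormula_real_le hw0 hs hsd
    _ ≤ (2 * (n / N)) ^ 2 * (2 * N) * (((3 * d + 1) * 2 ^ s) * (10 * d + 7)) +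
        (2 * (n / N)) * (2 * N) ^ 2 * (4 * d + 2) + 3 := by gcongr
    _ = (n ^ 2 / N) * (8 * (((3 * d + 1) * 2 ^ s) * (10 * d + 7))) +
        (n * N) * (8 * (4 * d + 2)) + 3 := by field_simp; ring
    _ ≤ (n ^ 2 / N) * (8 * (((3 * d + 1) * 2 ^ s) * (10 * d + 7))) +
        (n ^ 2 / N) * (8 * (4 * d + 2)) + (n ^ 2 / N) * 3 := by
          gcongr
          linarith
    _ = (n ^ 2 / N) * ((8 * ((3 * d + 1) * (10 * d + 7))) * 2 ^ s +
        (8 * (4 * d + 2) + 3) * 1) := by ring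
    _ ≤ (n ^ 2 / N) * ((8 * ((3 * d + 1) * (10 * d + 7))) * 2 ^ s +
        (8 * (4 * d + 2) + 3) * 2 ^ s) := by gcongr
    _ = (n ^ 2 / N) * ((8 * ((3 * d + 1) * (10 * d + 7)) + (8 * (4 * d + 2) + 3)) * 2 ^ s) := by
          ring
    _ ≤ (n ^ 2 / N) * ((336 * (d + 1) ^ 2) * 2 ^ s) := by
          gcongr
          nlinarith
    _ ≤ (n ^ 2 / N) * ((Real.exp 6 * Real.exp (2 * √d) ^ 2) * Real.exp √d) := by gcongr
    _ = (n ^ 2 / N) * Real.exp (6 + 5 * √d) := by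
          rw [← Real.exp_nat_mul, ← Real.exp_add, ← Real.exp_add]
          ring_nf
    _ ≤ (n ^ 2 / N) * Real.exp (6 + 5 * √(C * Real.log n)) := by gcongr
    _ ≤ (n ^ 2 / N) * Real.exp (η / 2 * Real.log n) := by gcongr
    _ = (n : ℝ) ^ (2 - η / 2) := by
          rw [mul_comm (η / 2), ← Real.rpow_def_of_pos hn0, hN, ← Real.rpow_natCast,
            ← Real.rpow_sub hn0, ← Real.rpow_add hn0]
          congr 1
          push_cast
          ring

end Asymptotics

/-! ### The critical range, d of order log n. -/

section Critical

variable {p : unitInterval}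

/-- The upper bound on θ' amounts to (1-p)log(1-p) + (1+p)log(1+p) > 0, where the first term exceeds
-p and the second is at least p. -/
theorem exists_rpow_eq_sqrt (hp0 : 0 < (p : ℝ)) (hp1 : (p : ℝ) < 1) :
    ∃ θ', 0 < θ' ∧ θ' < (p : ℝ) / (1 + p) ∧ (1 - (p : ℝ)) ^ θ' = √(1 - (p : ℝ) ^ 2) := by
  have h1 : 0 < 1 - (p : ℝ) := by linarith
  have h2 : 0 < 1 + (p : ℝ) := by linarith
  have hpp : 0 < 1 - (p : ℝ) ^ 2 := by nlinarith
  have hl1 : Real.log (1 - p) < 0 := Real.log_neg h1 (by linarith)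
  have hl2 : Real.log (1 - (p : ℝ) ^ 2) < 0 := Real.log_neg hpp (by nlinarith)
  have hsplit : Real.log (1 - (p : ℝ) ^ 2) = Real.log (1 - p) + Real.log (1 + p) := by
    rw [← Real.log_mul h1.ne' h2.ne']
    ring_nf
  refine ⟨Real.log (1 - (p : ℝ) ^ 2) / 2 / Real.log (1 - p), ?_, ?_, ?_⟩
  · exact div_pos_of_neg_of_neg (by linarith) hl1
  · rw [div_lt_iff_of_neg hl1, div_mul_eq_mul_div, div_lt_iff₀ h2]
    have ha : -p < (1 - (p : ℝ)) * Real.log (1 - p) := by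
      have := Real.log_lt_sub_one_of_pos (inv_pos.2 h1) (by
        rw [Ne, inv_eq_one]; linarith)
      rw [Real.log_inv] at this
      have h3 : (1 - (p : ℝ)) * (1 - (p : ℝ))⁻¹ = 1 := mul_inv_cancel₀ h1.ne'
      nlinarith
    have hb : (p : ℝ) ≤ (1 + p) * Real.log (1 + p) := by
      have := Real.one_sub_inv_le_log_of_pos h2
      have h3 : (1 + (p : ℝ)) * (1 + (p : ℝ))⁻¹ = 1 := mul_inv_cancel₀ h2.ne'
      nlinarith
    rw [hsplit]
    nlinarith
  · rw [Real.rpow_def_of_pos h1, mul_div_cancel₀ _ hl1.ne, Real.sqrt_eq_rpow,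
      Real.rpow_def_of_pos hpp]
    ring_nf

theorem tendsto_mul_pow_add_pow {a b : ℝ} (ha : 0 < a) (ha1 : a < 1) (hb : 0 < b) (hb1 : b < 1) :
    Tendsto (fun s : ℕ => (s : ℝ) * a ^ s + b ^ s) atTop (𝓝 0) := by
  simpa using (tendsto_self_mul_const_pow_of_lt_one ha.le ha1).add
    (tendsto_pow_atTop_nhds_zero_of_lt_one hb.le hb1)

theorem tendsto_sq_mul_pow_add_pow {a b : ℝ} (ha : 0 < a) (ha1 : a < 1) (hb : 0 < b)
    (hb1 : b < 1) :
    Tendsto (fun s : ℕ => 4 * ((s : ℝ) + 1) ^ 2 * (2 * s * a ^ s + 4 * b ^ s)) atTop (𝓝 0) := by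
  have h : ∀ (k : ℕ) {r : ℝ}, 0 < r → r < 1 →
      Tendsto (fun s : ℕ => (s : ℝ) ^ k * r ^ s) atTop (𝓝 0) := fun k r h0 h1 =>
    tendsto_pow_const_mul_const_pow_of_abs_lt_one k (by rwa [abs_of_pos h0])
  have h1 := ((((h 3 ha ha1).const_mul 8).add ((h 2 ha ha1).const_mul 16)).add
    ((h 1 ha ha1).const_mul 8)).add ((((h 2 hb hb1).const_mul 16).add
    ((h 1 hb hb1).const_mul 32)).add ((h 0 hb hb1).const_mul 16))
  simp only [mul_zero, add_zero] at h1
  refine h1.congr fun s => ?_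
  ring

theorem eventually_forall_sqrt {P : ℕ → Prop} (h : ∀ᶠ s in atTop, P s) :
    ∀ᶠ n : ℕ in atTop, ∀ d : ℕ, Real.log n < 4 * d → P (Nat.sqrt d) := by
  obtain ⟨s₀, hs₀⟩ := eventually_atTop.1 h
  filter_upwards [eventually_log_natCast (eventually_ge_atTop ((4 * (s₀ * s₀) : ℕ) : ℝ))]
    with n hn d hd
  refine hs₀ _ (Nat.le_sqrt.2 ?_)
  have : ((4 * (s₀ * s₀) : ℕ) : ℝ) < ((4 * d : ℕ) : ℝ) := by
    push_cast at hn ⊢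
    linarith
  have : 4 * (s₀ * s₀) < 4 * d := by exact_mod_cast this
  omega

/-- Here n^η ≤ e^{4ηd} ≤ e^{c(s²+2s)/2}, and (s²+2s)/2 - s² ≤ -s exactly when s ≥ 4 (for s > 0). -/
theorem ceil_rpow_mul_pow_le {n d s : ℕ} {η c : ℝ} (hn : 1 ≤ n) (hη : 0 ≤ η) (hc : 8 * η ≤ c)
    (hd : Real.log n < 4 * d) (hds : d ≤ s * s + 2 * s) (hs : 4 ≤ s) :
    (⌈(n : ℝ) ^ η⌉₊ : ℝ) * Real.exp (-c) ^ (s * s) ≤ 2 * Real.exp (-c) ^ s := by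
  have hn1 : (1 : ℝ) ≤ n := by exact_mod_cast hn
  have hn0 : (0 : ℝ) < n := by linarith
  have hN1 : 1 ≤ (n : ℝ) ^ η := Real.one_le_rpow hn1 hη
  have hw : (⌈(n : ℝ) ^ η⌉₊ : ℝ) ≤ 2 * (n : ℝ) ^ η := by
    linarith [(Nat.ceil_lt_add_one (zero_le_one.trans hN1)).le]
  have hds' : (d : ℝ) ≤ s * s + 2 * s := by exact_mod_cast hds
  have hs' : (4 : ℝ) ≤ s := by exact_mod_cast hs
  have hc0 : 0 ≤ c := by linarith
  calc _ ≤ 2 * (n : ℝ) ^ η * Real.exp (-c) ^ (s * s) := by gcongr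
    _ = 2 * Real.exp (Real.log n * η + (s * s : ℕ) * (-c)) := by
        rw [Real.rpow_def_of_pos hn0, ← Real.exp_nat_mul, Real.exp_add]
        ring
    _ ≤ 2 * Real.exp (s * (-c)) := by
        gcongr
        push_cast
        have h1 : Real.log n * η ≤ 4 * d * η := by gcongr
        have h2 : 4 * d * η ≤ (s * s + 2 * s) * (c / 2) := by
          calc 4 * d * η = d * (4 * η) := by ring
            _ ≤ (s * s + 2 * s) * (c / 2) := by
              gcongr
              linarith
        have h3 : 0 ≤ (s - 4) * s * c := by
          have : 0 ≤ (s : ℝ) - 4 := by linarith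
          positivity
        linarith
    _ = _ := by rw [Real.exp_nat_mul]

theorem exists_subsample {n : ℕ} {L r : ℝ} (hL : 1 < L) (hr0 : 0 < r) (hr1 : r ≤ 1)
    (h : L < n ^ 2 * r ^ 2) :
    ∃ m : ℕ, 2 ≤ m ∧ m ≤ n ∧ √L / 4 ≤ (m / 2 : ℕ) * r ∧ (m : ℝ) ^ 2 * r ^ 2 ≤ 4 * L := by
  have hsL : 1 < √L := by rwa [Real.lt_sqrt zero_le_one, one_pow]
  have hquot : 1 < √L / r := by
    rw [lt_div_iff₀ hr0]
    linarith
  obtain ⟨m, hm⟩ : ∃ m, m = ⌈√L / r⌉₊ := ⟨_, rfl⟩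
  have hml : √L / r ≤ m := hm ▸ Nat.le_ceil _
  have hmu : (m : ℝ) ≤ 2 * (√L / r) := by
    rw [hm]
    linarith [Nat.ceil_lt_add_one (show 0 ≤ √L / r by positivity)]
  have hm2 : 2 ≤ m := by
    have : (1 : ℝ) < m := by linarith
    exact_mod_cast this
  refine ⟨m, hm2, ?_, ?_, ?_⟩
  · rw [hm, Nat.ceil_le, div_le_iff₀ hr0]
    refine Real.sqrt_le_iff.2 ⟨by positivity, ?_⟩
    linarith [mul_pow (n : ℝ) r 2]
  · have h1 : m ≤ 4 * (m / 2) := by omega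
    have h2 : (m : ℝ) ≤ 4 * (m / 2 : ℕ) := by exact_mod_cast h1
    rw [div_le_iff₀ hr0] at hml
    nlinarith
  · rw [mul_div_assoc', le_div_iff₀ hr0] at hmu
    calc (m : ℝ) ^ 2 * r ^ 2 = (m * r) ^ 2 := by ring
      _ ≤ (2 * √L) ^ 2 := by gcongr
      _ = 4 * L := by
        rw [mul_pow, Real.sq_sqrt (by linarith)]
        norm_num

theorem exists_eventually_solvable_critical (hp0 : 0 < (p : ℝ)) (hp1 : (p : ℝ) < 1) :
    ∃ η : ℝ, 0 < η ∧ η ≤ 1 / 4 ∧ ∀ e > 0, ∀ᶠ n : ℕ in atTop, ∀ d : ℕ, Real.log n < 4 * d →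
      -Real.log (1 - (p : ℝ) ^ 2) * d ≤ 3 * Real.log n →
      Solvable p n d ((n : ℝ) ^ (2 - η / 2)) e := by
  have hpp : 0 < 1 - (p : ℝ) ^ 2 := by nlinarith
  have hΛ : 0 < -Real.log (1 - (p : ℝ) ^ 2) := by
    have := Real.log_neg hpp (by nlinarith)
    linarith
  obtain ⟨θ', hθ'0, hθ', hσ⟩ := exists_rpow_eq_sqrt hp0 hp1
  have hα0 : 0 < (p : ℝ) / (1 + p) := by positivity
  have hαp : (p : ℝ) / (1 + p) < p := by
    rw [div_lt_iff₀ (by positivity)]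
    nlinarith
  obtain ⟨θ, hθ, hθp⟩ := exists_between hαp
  have hρ₁ := chernoff_pos (θ := θ) hα0 (hαp.trans hp1)
  have hρ₁' := chernoff_lt_one hα0 (hαp.trans hp1) (hα0.trans hθ) (hθp.trans hp1) hθ.ne
  have hρ₂ := chernoff_pos (θ := θ) hp0 hp1
  have hρ₂' := chernoff_lt_one hp0 hp1 (hα0.trans hθ) (hθp.trans hp1) hθp.ne'
  have hρ₃ := chernoff_pos (θ := θ') hα0 (hαp.trans hp1)
  have hρ₃' := chernoff_lt_one hα0 (hαp.trans hp1) hθ'0 (hθ'.trans (hαp.trans hp1)) hθ'.ne'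
  set ρ₁ := chernoff (p / (1 + p)) θ
  set ρ₂ := chernoff p θ
  set ρ₃ := chernoff (p / (1 + p)) θ'
  obtain ⟨c, hc⟩ : ∃ c, c = -Real.log ρ₂ := ⟨_, rfl⟩
  have hc0 : 0 < c := by
    have := Real.log_neg hρ₂ hρ₂'
    linarith
  have hcρ : Real.exp (-c) = ρ₂ := by rw [hc, neg_neg, Real.exp_log hρ₂]
  -- The bound 1/4 serves the size estimate; c/8 keeps the bucket size below the rarity of light
  -- vectors.
  obtain ⟨η, hη⟩ : ∃ η, η = min (1 / 4) (c / 8) := ⟨_, rfl⟩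
  have hη0 : 0 < η := by rw [hη]; positivity
  have hη4 : η ≤ 1 / 4 := hη ▸ min_le_left _ _
  have hηc : 8 * η ≤ c := by
    have : η ≤ c / 8 := hη ▸ min_le_right _ _
    linarith
  refine ⟨η, hη0, hη4, fun e he => ?_⟩
  have hlimL : ∀ᶠ L : ℝ in atTop, 32 / √L + 64 / L ≤ e / 2 := by
    have : Tendsto (fun L : ℝ => 32 / √L + 64 / L) atTop (𝓝 (0 + 0)) :=
      (tendsto_const_nhds.div_atTop Real.tendsto_sqrt_atTop).add
        (tendsto_const_nhds.div_atTop tendsto_id)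
    rw [add_zero] at this
    exact this.eventually_le_const (by positivity)
  have hlimG := (tendsto_sq_mul_pow_add_pow hρ₁ hρ₁' hρ₂ hρ₂').eventually_le_const
    (show 0 < e / 8 by positivity)
  have hlimH := (tendsto_mul_pow_add_pow hρ₁ hρ₁' hρ₃ hρ₃').eventually_le_const
    (show (0 : ℝ) < 1 / 4 by positivity)
  filter_upwards [eventually_forall_sqrt (hlimG.and (hlimH.and (eventually_ge_atTop 4))),
    eventually_log_natCast hlimL, eventually_log_natCast (eventually_gt_atTop 1),
    eventually_ge_atTop 1,
    eventually_size_searchFormula_le (C := 3 / -Real.log (1 - (p : ℝ) ^ 2)) (by positivity) hη0 hη4]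
    with n hns hnL hL1 hn1 hsize d hd hdΛ
  obtain ⟨hG, hH, hs4⟩ := hns d hd
  obtain ⟨s, hs⟩ : ∃ s, s = Nat.sqrt d := ⟨_, rfl⟩
  obtain ⟨w, hw⟩ : ∃ w, w = ⌈(n : ℝ) ^ η⌉₊ := ⟨_, rfl⟩
  rw [← hs] at hG hH hs4
  have hs0 : 0 < s := by omega
  have hsd : s * s ≤ d := hs ▸ Nat.sqrt_le d
  have hds : d ≤ s * s + 2 * s := by
    have := Nat.sqrt_le_add d
    rw [← hs] at this
    omega
  have hn0 : (0 : ℝ) < n := by exact_mod_cast hn1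
  have hw0 : 0 < w := by
    rw [hw, Nat.ceil_pos]
    positivity
  have hwρ : (w : ℝ) * ρ₂ ^ (s * s) ≤ 2 * ρ₂ ^ s := by
    have := ceil_rpow_mul_pow_le hn1 hη0.le hηc hd hds hs4
    rwa [hcρ, ← hw] at this
  have hLs : Real.log n ≤ 4 * ((s : ℝ) + 1) ^ 2 := by
    have h1 : (d : ℝ) ≤ s * s + 2 * s := by exact_mod_cast hds
    nlinarith
  have hdC : (d : ℝ) ≤ 3 / -Real.log (1 - (p : ℝ) ^ 2) * Real.log n := by
    rw [div_mul_eq_mul_div, le_div_iff₀ hΛ]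
    linarith
  have hsize' := fun m => hsize d m s w θ hs0 hsd hdC hw
  have hLnn : 0 ≤ Real.log n := by linarith
  -- The threshold log n is at most 4(s+1)², hence beaten by errors exponentially small in s, yet it
  -- tends to infinity as the second moment bound requires.
  by_cases hcase : (n : ℝ) ^ 2 * (1 - (p : ℝ) ^ 2) ^ d ≤ Real.log n
  · refine ⟨searchFormula n d n w s θ, depth_searchFormula_le, hsize' n le_rfl,
      hasOrthogonalPair_of_output_searchFormula,
      (searchFormula_error_le_of_full hw0 hs0 hsd hθp hθ).trans ?_⟩
    calc _ ≤ (4 * ((s : ℝ) + 1) ^ 2) * (2 * s * ρ₁ ^ s + 4 * ρ₂ ^ s) := by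
          refine mul_le_mul (hcase.trans hLs) ?_ (by positivity) (by positivity)
          linarith
      _ ≤ e := by linarith
  · rw [not_le] at hcase
    obtain ⟨r, hr⟩ : ∃ r, r = √(1 - (p : ℝ) ^ 2) ^ d := ⟨_, rfl⟩
    have hr0 : 0 < r := by rw [hr]; positivity
    have hr1 : r ≤ 1 := by
      rw [hr]
      exact pow_le_one₀ (Real.sqrt_nonneg _) (Real.sqrt_le_one.2 (by nlinarith))
    have hrq : (1 - (p : ℝ) ^ 2) ^ d = r ^ 2 := by
      rw [hr, ← pow_mul, mul_comm d, pow_mul, Real.sq_sqrt hpp.le]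
    rw [hrq] at hcase
    obtain ⟨m, hm2, hmn, hhalf, hmr⟩ := exists_subsample hL1 hr0 hr1 hcase
    have hsmall : s * ρ₁ ^ s + ρ₃ ^ d ≤ 1 / 4 := by
      have : ρ₃ ^ d ≤ ρ₃ ^ s :=
        pow_le_pow_of_le_one hρ₃.le hρ₃'.le ((Nat.le_mul_self s).trans hsd)
      linarith
    refine ⟨searchFormula n d m w s θ, depth_searchFormula_le, hsize' m hmn,
      hasOrthogonalPair_of_output_searchFormula,
      (searchFormula_error_le_of_many hm2 hmn hw0 hs0 hsd hp1 hθp hθ hθ' hsmall hσ.le).trans ?_⟩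
    rw [hrq, ← hr]
    have hL0 : 0 < Real.log n := by linarith
    have hz : 0 < √(Real.log n) / 4 := by positivity
    have h1 : 8 / ((m / 2 : ℕ) * r) + 4 / ((m / 2 : ℕ) * r) ^ 2 ≤ e / 2 := by
      calc _ ≤ 8 / (√(Real.log n) / 4) + 4 / (√(Real.log n) / 4) ^ 2 := by gcongr
        _ = 32 / √(Real.log n) + 64 / Real.log n := by
            rw [div_pow, Real.sq_sqrt hLnn]
            field_simp
            ring
        _ ≤ e / 2 := hnL
    have h2 : (m : ℝ) ^ 2 * r ^ 2 * (2 * w * ρ₂ ^ (s * s)) ≤ e / 2 := by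
      have h3 : 0 ≤ (s : ℝ) * ρ₁ ^ s := by positivity
      calc _ ≤ (4 * (4 * ((s : ℝ) + 1) ^ 2)) * (2 * s * ρ₁ ^ s + 4 * ρ₂ ^ s) := by
            refine mul_le_mul (hmr.trans (by linarith)) ?_ (by positivity) (by positivity)
            linarith
        _ ≤ e / 2 := by linarith
    linarith

end Critical

/-! ### Assembling the ranges, the exponents ε_p and the errors δ_p. -/

section Assembly

variable {p : unitInterval}

theorem exists_eventually_solvable (hp0 : 0 < (p : ℝ)) (hp1 : (p : ℝ) < 1) :
    ∃ ε : ℝ, 0 < ε ∧ ε ≤ 1 ∧ ∀ e > 0, ∀ᶠ n : ℕ in atTop, ∀ d : ℕ,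
      Solvable p n d ((n : ℝ) ^ (2 - ε)) e := by
  obtain ⟨η, hη0, hη4, h⟩ := exists_eventually_solvable_critical hp0 hp1
  refine ⟨η / 2, by positivity, by linarith, fun e he => ?_⟩
  filter_upwards [h e he, eventually_solvable_of_dense (p := p) (a := 1 / 4) (b := 1 / 2)
    (by norm_num), eventually_ge_atTop 1,
    tendsto_one_div_atTop_nhds_zero_nat.eventually_le_const he] with n hcrit hdense hn hne d
  have hn1 : (1 : ℝ) ≤ n := by exact_mod_cast hn
  by_cases h1 : Real.log n < 4 * d
  · by_cases h2 : -Real.log (1 - (p : ℝ) ^ 2) * d ≤ 3 * Real.log n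
    · exact hcrit d h1 h2
    · exact (solvable_of_sparse hp1 hn (not_le.1 h2).le).mono
        (Real.one_le_rpow hn1 (by linarith)) hne
  · exact (hdense d (by linarith)).mono (Real.rpow_le_rpow_of_exponent_le hn1 (by linarith)) he.le

/-- The sparse and dense ranges meet at d = (3/Λ) log n, so no critical range is left; 4/Λ instead
of 3/Λ is the slack in the dense size. -/
theorem eventually_solvable_of_large (hp1 : (p : ℝ) < 1)
    (hΛ : 4 < -Real.log (1 - (p : ℝ) ^ 2)) (e : ℝ) (he : 0 < e) :
    ∀ᶠ n : ℕ in atTop, ∀ d : ℕ,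
      Solvable p n d ((n : ℝ) ^ (2 - (1 - 4 / -Real.log (1 - (p : ℝ) ^ 2)))) e := by
  set Λ := -Real.log (1 - (p : ℝ) ^ 2) with hΛdef
  have hΛ0 : 0 < Λ := by linarith
  filter_upwards [eventually_solvable_of_dense (p := p) (a := 3 / Λ) (b := 4 / Λ)
    (by gcongr; norm_num), eventually_ge_atTop 1,
    tendsto_one_div_atTop_nhds_zero_nat.eventually_le_const he] with n hdense hn hne d
  have hn1 : (1 : ℝ) ≤ n := by exact_mod_cast hn
  have h41 : 0 < 4 / Λ := by positivity
  by_cases h2 : 3 * Real.log n ≤ Λ * d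
  · exact (solvable_of_sparse hp1 hn h2).mono (Real.one_le_rpow hn1 (by linarith)) hne
  · refine (hdense d ?_).mono (Real.rpow_le_rpow_of_exponent_le hn1 (by linarith)) he.le
    rw [div_mul_eq_mul_div, le_div_iff₀ hΛ0]
    linarith

/-- A property holding eventually for each error `e > 0` holds with an error tending to `0`. -/
theorem exists_tendsto_of_eventually {Q : ℕ → ℝ → Prop}
    (hone : ∀ n, 1 ≤ n → Q n 1)
    (h : ∀ e > 0, ∀ᶠ n in atTop, Q n e) :
    ∃ δ : ℕ → ℝ, Tendsto δ atTop (𝓝 0) ∧ ∀ n, 1 ≤ n → Q n (δ n) := by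
  classical
  have h' : ∀ k : ℕ, ∃ N, ∀ n ≥ N, Q n (1 / ((k : ℝ) + 1)) := fun k =>
    eventually_atTop.1 (h _ (by positivity))
  choose N hN using h'
  -- Diagonal choice. The default value 0 gives the trivial error 1, which `hone` covers.
  let κ : ℕ → ℕ := fun n => Nat.findGreatest (fun k => N k ≤ n) n
  refine ⟨fun n => 1 / ((κ n : ℝ) + 1), ?_, fun n hn => ?_⟩
  · refine tendsto_one_div_add_atTop_nhds_zero_nat.comp (tendsto_atTop.2 fun k => ?_)
    filter_upwards [eventually_ge_atTop k, eventually_ge_atTop (N k)] with n h1 h2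
    exact Nat.le_findGreatest h1 h2
  · by_cases h0 : κ n = 0
    · simpa [h0] using hone n hn
    · exact hN _ n (Nat.findGreatest_of_ne_zero (P := fun k => N k ≤ n) rfl h0)

theorem tendsto_one_sub_four_div_log :
    Tendsto (fun p : ℝ => 1 - 4 / -Real.log (1 - p ^ 2)) (𝓝[<] 1) (𝓝 1) := by
  have h1 : Tendsto (fun p : ℝ => 1 - p ^ 2) (𝓝[<] 1) (𝓝[>] 0) := by
    refine tendsto_nhdsWithin_iff.2 ⟨?_, ?_⟩
    · have : Tendsto (fun p : ℝ => 1 - p ^ 2) (𝓝 1) (𝓝 (1 - 1 ^ 2)) :=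
        (continuous_const.sub (continuous_pow 2)).tendsto 1
      simpa using this.mono_left nhdsWithin_le_nhds
    · filter_upwards [Ioo_mem_nhdsLT (show (0 : ℝ) < 1 by norm_num)] with p hp
      simp only [Set.mem_Ioi]
      nlinarith [hp.1, hp.2]
  have h2 : Tendsto (fun p : ℝ => -Real.log (1 - p ^ 2)) (𝓝[<] 1) atTop :=
    tendsto_neg_atBot_atTop.comp (Real.tendsto_log_nhdsGT_zero.comp h1)
  simpa using (tendsto_const_nhds (x := (4 : ℝ))).div_atTop h2 |>.const_sub 1

theorem exists_exponents : ∃ ε : ℝ → ℝ, (∀ p ∈ Set.Ioo (0 : ℝ) 1, 0 < ε p) ∧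
    Tendsto ε (𝓝[<] 1) (𝓝 1) ∧ ∀ (p : ℝ) (hp : p ∈ Set.Ioo (0 : ℝ) 1), ε p ≤ 1 ∧
      ∀ e > 0, ∀ᶠ n : ℕ in atTop, ∀ d : ℕ,
        Solvable ⟨p, Set.Ioo_subset_Icc_self hp⟩ n d ((n : ℝ) ^ (2 - ε p)) e := by
  classical
  -- The second clause pins the chosen exponent to its explicit value when Λ > 4, so that the limit
  -- at 1 can be read off.
  have hex : ∀ p : ℝ, ∃ ε : ℝ, (∀ hp : p ∈ Set.Ioo (0 : ℝ) 1, 0 < ε ∧ ε ≤ 1 ∧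
      ∀ e > 0, ∀ᶠ n : ℕ in atTop, ∀ d : ℕ,
        Solvable ⟨p, Set.Ioo_subset_Icc_self hp⟩ n d ((n : ℝ) ^ (2 - ε)) e) ∧
      (4 < -Real.log (1 - p ^ 2) → ε = 1 - 4 / -Real.log (1 - p ^ 2)) := fun p => by
    by_cases hΛ : 4 < -Real.log (1 - p ^ 2)
    · refine ⟨_, fun hp => ⟨?_, ?_, fun e he => ?_⟩, fun _ => rfl⟩
      · rw [sub_pos, div_lt_one (by linarith)]
        exact hΛ
      · have : 0 ≤ 4 / -Real.log (1 - p ^ 2) := div_nonneg (by norm_num) (by linarith)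
        linarith
      · exact eventually_solvable_of_large (p := ⟨p, Set.Ioo_subset_Icc_self hp⟩) hp.2 hΛ e he
    · by_cases hp : p ∈ Set.Ioo (0 : ℝ) 1
      · obtain ⟨ε, h⟩ := exists_eventually_solvable (p := ⟨p, Set.Ioo_subset_Icc_self hp⟩) hp.1 hp.2
        exact ⟨ε, fun _ => h, fun h => absurd h hΛ⟩
      · exact ⟨0, fun h => absurd h hp, fun h => absurd h hΛ⟩
  choose ε hε hεl using hex
  refine ⟨ε, fun p hp => (hε p hp).1, ?_, fun p hp => (hε p hp).2⟩
  refine tendsto_one_sub_four_div_log.congr' ?_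
  have h4 : ∀ᶠ p : ℝ in 𝓝[<] 1, 0 < 1 - 4 / -Real.log (1 - p ^ 2) :=
    tendsto_one_sub_four_div_log.eventually_const_lt one_pos
  filter_upwards [h4, Ioo_mem_nhdsLT (show (0 : ℝ) < 1 by norm_num)] with p h hp
  have hΛ : 0 < -Real.log (1 - p ^ 2) := by
    have := Real.log_neg (show 0 < 1 - p ^ 2 by nlinarith [hp.1, hp.2])
      (by nlinarith [hp.1])
    linarith
  rw [sub_pos, div_lt_one hΛ] at h
  exact (hεl p h).symm

end Assembly

theorem theorem4 :
    ∃ (ε : ℝ → ℝ) (D : ℕ),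
      (∀ p ∈ Set.Ioo (0 : ℝ) 1, 0 < ε p) ∧
      Tendsto ε (𝓝[<] 1) (𝓝 1) ∧
      ∀ (p : ℝ) (hp : p ∈ Set.Ioo (0 : ℝ) 1),
        ∃ δ : ℕ → ℝ, Tendsto δ atTop (𝓝 0) ∧
          ∀ n d : ℕ, 1 ≤ n →
            ∃ F : BoolFormula (Fin n × Fin d),
              F.depth ≤ D ∧
              (F.size : ℝ) ≤ (n : ℝ) ^ (2 - ε p) ∧
              (∀ x : OVInstance n d, F.output x = true → x.HasOrthogonalPair) ∧
              (ovMeasure ⟨p, Set.Ioo_subset_Icc_self hp⟩ n d).real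
                {x | ¬ (F.output x = true ↔ x.HasOrthogonalPair)} ≤ δ n := by
  obtain ⟨ε, hpos, hlim, h⟩ := exists_exponents
  refine ⟨ε, 12, hpos, hlim, fun p hp => ?_⟩
  obtain ⟨hε1, hsol⟩ := h p hp
  obtain ⟨δ, hδ, hQ⟩ := exists_tendsto_of_eventually
    (Q := fun n e => ∀ d, Solvable ⟨p, Set.Ioo_subset_Icc_self hp⟩ n d ((n : ℝ) ^ (2 - ε p)) e)
    -- The constant 0 has size 1, which fits because ε_p ≤ 1; it handles every small n with error 1.
    (fun n hn d => (solvable_const_false n d).mono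
      (Real.one_le_rpow (by exact_mod_cast hn) (by linarith)) measureReal_le_one) hsol
  exact ⟨δ, hδ, fun n d hn => hQ n hn d⟩
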